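/- Let $n\ge 0$. All graphs are simple graphs on the node set $\{1,\dots,n+1\}$, and every labeled tree (a tree on this node set) is rooted at the node $n+1$. **Neighbors-first search (NFS).** Given a connected graph $G$, the node $n+1$ is the $0$-th visited node and the first active node. At each step, visit the previously unvisited neighbors of the active node in decreasing order of their labels and make the one with the smallest label the new active node; if all neighbors of the active node have already been visited, the last visited node that has not been active becomes the new active node. The edges joining an active node to the neighbors newly visited from it form the search tree $\Phi(G)$, a labeled tree. **Coordinates.** Let $T$ be a labeled tree. For each node $v$ let $i(v)\in\{0,\dots,n\}$ be its position in the NFS on $T$, and define an exponent $j(v)\ge 0$ as follows: $j(n+1)=0$, and if $v$ has successors $v_1<\dots<v_k$, then $j(v_k)=j(v),\ j(v_{k-1})=j(v)+1,\ \dots,\ j(v_1)=j(v)+k-1$. Put $\alpha(T)=\sum_{k=1}^n j(k)$ and $$S_T=\Big\{(x_1,\dots,x_n)\in\mathbb R^n:\ 1\le \frac{x_{i(1)}}{2^{j(1)}}\le \frac{x_{i(2)}}{2^{j(2)}}\le\dots\le\frac{x_{i(n)}}{2^{j(n)}}\le 2\Big\}.$$ Let $C_n\subset\mathbb R^n$ be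 the Cayley polytope, given by $1\le x_1\le 2$ and $1\le x_i\le 2x_{i-1}$ for $i=2,\dots,n$. **Theorem.** For every labeled tree $T$ on $n+1$ nodes, $S_T$ is an $n$-simplex; more precisely it is a Schläfli orthoscheme with parameters $2^{j(n)},2^{j(n-1)},\dots,2^{j(1)}$, i.e. up to a permutation of the coordinates and a translation it is the convex hull of the $n+1$ points $(\ell_1,\dots,\ell_m,0,\dots,0)$, $0\le m\le n$, where $\ell_m=2^{j(n+1-m)}$. Moreover $$n!\,\operatorname{vol} S_T=\#\{G \text{ connected graph on } \{1,\dots,n+1\}:\ \Phi(G)=T\}=2^{\alpha(T)}.$$ Furthermore, the simplices $S_T$, where $T$ runs over all labeled trees on $n+1$ nodes, triangulate $C_n$: their union is $C_n$, the interiors of $S_T$ and $S_{T'}$ are disjoint for $T\ne T'$, and any two of them intersect in a common (possibly empty) face. In particular, $n!\,\operatorname{vol} C_n$ is the number of connected graphs on $\{1,\dots,n+1\}$. -/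

import Mathlib

open scoped ENNReal Nat

namespace CayleyPolytope

/-! Graphs on `n + 1` labeled nodes are `SimpleGraph (Fin (n + 1))`; the node with label `k`
(for `1 ≤ k ≤ n + 1`) is the element of `Fin (n + 1)` with value `k - 1`, so that `Fin.last n` is the
node with the maximal label and the nodes `1, …, n` are the `k.castSucc` with `k : Fin n`.
Likewise the coordinate `x_i` (for `1 ≤ i ≤ n`) of a point `x : Fin n → ℝ` is `x` at `i - 1`. -/

/-- The state of a neighbors-first search: the nodes visited so far (in the order of the visits),
those of them that have not been active yet (most recently visited first), and the edges
(active node, newly visited neighbor) of the search tree. -/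
structure NFSState (n : ℕ) where
  visited : List (Fin (n + 1))
  pending : List (Fin (n + 1))
  edges : List (Fin (n + 1) × Fin (n + 1))

/-- At the start, only the node with the maximal label has been visited; it is the first to
become active. -/
def nfsInit (n : ℕ) : NFSState n where
  visited := [Fin.last n]
  pending := [Fin.last n]
  edges := []

/-- The unvisited neighbors of the node `a`, in decreasing order of their labels. -/
def newNeighbors {n : ℕ} (G : SimpleGraph (Fin (n + 1))) [DecidableRel G.Adj]
    (visited : List (Fin (n + 1))) (a : Fin (n + 1)) : List (Fin (n + 1)) :=
  (List.finRange (n + 1)).reverse.filter fun w => G.Adj a w ∧ w ∉ visited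

/-- One step of the search. The last visited node `a` that has not been active becomes active
and its unvisited neighbors are visited in decreasing order of their labels. Afterwards the head of
`pending` is the newly visited neighbor with the smallest label if there is one, and otherwise
the last visited node that has not been active: it is the next active node. -/
def nfsStep {n : ℕ} (G : SimpleGraph (Fin (n + 1))) [DecidableRel G.Adj] (s : NFSState n) :
    NFSState n :=
  match s.pending with
  | [] => s
  | a :: rest =>
    { visited := s.visited ++ newNeighbors G s.visited a
      pending := (newNeighbors G s.visited a).reverse ++ rest
      edges := s.edges ++ (newNeighbors G s.visited a).map fun w => (a, w) }

/-- The final state of the search. Every node is active at most once, so `n + 1` steps suffice. -/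
def nfsRun {n : ℕ} (G : SimpleGraph (Fin (n + 1))) [DecidableRel G.Adj] : NFSState n :=
  (nfsStep G)^[n + 1] (nfsInit n)

open Classical in
/-- The search tree `Φ(G)` of the neighbors-first search on `G`. -/
noncomputable def nfsTree {n : ℕ} (G : SimpleGraph (Fin (n + 1))) : SimpleGraph (Fin (n + 1)) :=
  SimpleGraph.fromRel fun u v => (u, v) ∈ (nfsRun G).edges

open Classical in
/-- The position of the node `v` in the neighbors-first search on `G`; the root has position `0`. -/
noncomputable def nfsPos {n : ℕ} (G : SimpleGraph (Fin (n + 1))) (v : Fin (n + 1)) : ℕ :=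
  (nfsRun G).visited.idxOf v

/-- In the tree `T`, rooted at the node with the maximal label, `w` is a successor (child)
of `v`. -/
def IsSucc {n : ℕ} (T : SimpleGraph (Fin (n + 1))) (v w : Fin (n + 1)) : Prop :=
  T.Adj v w ∧ T.dist (Fin.last n) w = T.dist (Fin.last n) v + 1

open Classical in
/-- The parent of a node of a tree that is rooted at the node with the maximal label
(and the node itself if it has none). -/
noncomputable def parent {n : ℕ} (T : SimpleGraph (Fin (n + 1))) (w : Fin (n + 1)) : Fin (n + 1) :=
  if h : ∃ v, IsSucc T v w then h.choose else w

/-- The exponent of a node at distance `d` from the root. The exponent of the root is `0`; if `v` has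
exponent `j` and successors `v_1 < ⋯ < v_k`, then `v_k, v_{k-1}, …, v_1` have the exponents
`j, j + 1, …, j + k - 1`, i.e. one adds to `j` the number of successors of `v` with a larger
label. -/
noncomputable def exponentAux {n : ℕ} (T : SimpleGraph (Fin (n + 1))) : ℕ → Fin (n + 1) → ℕ
  | 0, _ => 0
  | d + 1, w =>
      exponentAux T d (parent T w) + {u | IsSucc T (parent T w) u ∧ w < u}.ncard

/-- The exponent `j` in the coordinate `x_i / 2 ^ j` that is attached to a node of the tree `T`. -/
noncomputable def exponent {n : ℕ} (T : SimpleGraph (Fin (n + 1))) (v : Fin (n + 1)) : ℕ :=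
  exponentAux T (T.dist (Fin.last n) v) v

/-- `α(T)`, the sum of the exponents `j_1, …, j_n` of the nodes `1, …, n`; the exponent of
the root is `0`. -/
noncomputable def alpha {n : ℕ} (T : SimpleGraph (Fin (n + 1))) : ℕ :=
  ∑ k : Fin n, exponent T k.castSucc

/-- The `i`-th coordinate `x_i` of a point, `1 ≤ i ≤ n`, with `x_0 = 1` (and `0` for `i > n`). -/
def coordVal {n : ℕ} (x : Fin n → ℝ) : ℕ → ℝ
  | 0 => 1
  | i + 1 => if h : i < n then x ⟨i, h⟩ else 0

/-- The value at the point `x` of the coordinate `x_i / 2 ^ j` of the node `v` of `T`, where `i` is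
the position of `v` in the neighbors-first search on `T` and `j` its exponent. -/
noncomputable def nodeCoord {n : ℕ} (T : SimpleGraph (Fin (n + 1))) (x : Fin n → ℝ)
    (v : Fin (n + 1)) : ℝ :=
  coordVal x (nfsPos T v) / 2 ^ exponent T v

/-- The set `S_T` of all points at which the coordinates `c_k` of the nodes `k = 1, …, n` of `T`
satisfy `1 ≤ c_1 ≤ c_2 ≤ ⋯ ≤ c_n ≤ 2`. -/
def treeSimplex {n : ℕ} (T : SimpleGraph (Fin (n + 1))) : Set (Fin n → ℝ) :=
  {x | (∀ k : Fin n, 1 ≤ nodeCoord T x k.castSucc) ∧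
    (∀ k l : Fin n, k ≤ l → nodeCoord T x k.castSucc ≤ nodeCoord T x l.castSucc) ∧
    ∀ k : Fin n, nodeCoord T x k.castSucc ≤ 2}

/-- The Cayley polytope: `1 ≤ x_1 ≤ 2` and `1 ≤ x_i ≤ 2 x_{i-1}` for `i = 2, …, n`. -/
def cayleyPolytope (n : ℕ) : Set (Fin n → ℝ) :=
  {x | ∀ i : Fin n, 1 ≤ x i ∧ ((i : ℕ) = 0 → x i ≤ 2) ∧
    ∀ j : Fin n, (j : ℕ) + 1 = i → x i ≤ 2 * x j}

/-- An `n`-simplex in `ℝ^n`: the convex hull of `n + 1` affinely independent points. -/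
def IsSimplex {n : ℕ} (S : Set (Fin n → ℝ)) : Prop :=
  ∃ p : Fin (n + 1) → Fin n → ℝ, AffineIndependent ℝ p ∧ S = convexHull ℝ (Set.range p)

/-- `O(ℓ_1, …, ℓ_n)`, the convex hull of the points `(ℓ_1, …, ℓ_m, 0, …, 0)`, `0 ≤ m ≤ n`. -/
def pathSimplex {n : ℕ} (ℓ : Fin n → ℝ) : Set (Fin n → ℝ) :=
  convexHull ℝ (Set.range fun (m : Fin (n + 1)) (i : Fin n) => if (i : ℕ) < m then ℓ i else 0)

/-- `S` is a Schläfli orthoscheme with parameters `ℓ_1, …, ℓ_n > 0`: it arises from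
`O(ℓ_1, …, ℓ_n)` by a permutation of the coordinates and a translation. -/
def IsOrthoscheme {n : ℕ} (ℓ : Fin n → ℝ) (S : Set (Fin n → ℝ)) : Prop :=
  (∀ i, 0 < ℓ i) ∧ ∃ (σ : Equiv.Perm (Fin n)) (a : Fin n → ℝ),
    S = (fun (y : Fin n → ℝ) (i : Fin n) => a i + y (σ i)) '' pathSimplex ℓ

/-- The sets `S i` triangulate `P ⊆ ℝ^n`: they are finitely many `n`-simplices with union `P` and
with pairwise disjoint interiors, and any two of them intersect in a common (possibly empty)
face. -/
structure IsTriangulation {n : ℕ} {ι : Type} (S : ι → Set (Fin n → ℝ)) (P : Set (Fin n → ℝ)) :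
    Prop where
  finite : Finite ι
  isSimplex : ∀ i, IsSimplex (S i)
  iUnion_eq : ⋃ i, S i = P
  disjoint_interior : ∀ i j, i ≠ j → Disjoint (interior (S i)) (interior (S j))
  inter_isExposed : ∀ i j, IsExposed ℝ (S i) (S i ∩ S j) ∧ IsExposed ℝ (S j) (S i ∩ S j)

end CayleyPolytope

namespace CayleyPolytope

/-! Writing every coordinate as `x_i = 2 ^ e * c` with `1 ≤ c ≤ 2` and sorting the numbers `c`
covers `[1, ∞)^n` by alcoves, one for each permutation `p` of the coordinates and each choice `e` of
exponents. A diagonal map carries an alcove to one of the `n!` congruent pieces into which the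
orderings of the coordinates cut the cube `[1, 2]^n`. Hence alcoves are orthoschemes of volume `2 ^
(∑ e) / n!`, with null overlaps, and they meet in common faces (`isOrthoscheme_alcove`,
`volume_alcove`, `volume_alcove_inter`, `isExposed_alcove_inter`). The set `S_T` is the alcove given
by the positions and the exponents of the nodes of `T` (`treeSimplex_eq_alcove`), so the geometry
needs no trees.

For the count, view the pending nodes of a search as a stack and let `R w` be the set of nodes below
`w` on it. Below `w` lie the nodes that were below its parent and the larger siblings of `w`, which
is the recursion for exponents; so the exponent of `w` is the size of `R w` (`Run.card_below`,
`CompleteRun.exponent_tree`). An edge of a connected graph outside its search tree joins some `w` to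
a node of `R w` (`edge_or_below`), and such edges can be added to a tree freely without changing the
search (`CompleteRun.nfsRun_eq`). So a tree `T` is the search tree of `2 ^ alpha T` connected
graphs.

Trees and polytope are linked by the exponents in the order of the visits. The first one after the
root is `0`, and from one node to the next the exponent does not rise, or rises by one while the
label falls (`Run.isChain`). In an alcove, the second case makes the scaled coordinates satisfy `c_i
≤ c_{i-1}`, that is `x_i ≤ 2 x_{i-1}`; in the first case this bound is automatic. Conversely, the
height of the stack dictates where each list of children begins and ends, so every such sequence
comes from exactly one tree (`exists_tree`, `eq_of_nfsPos_eq_of_exponent_eq`), and each point of the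
polytope lies in an alcove of this kind (`exists_mem_treeSimplex`). -/

/-! ### Alcoves -/

/-- The `k`-th coordinate of the alcove attached to a permutation and to exponents. -/
noncomputable def scaled {n : ℕ} (p : Equiv.Perm (Fin n)) (e : Fin n → ℕ) (k : Fin n) :
    StrongDual ℝ (Fin n → ℝ) :=
  ((2 : ℝ) ^ e k)⁻¹ • (ContinuousLinearMap.proj (p k) : StrongDual ℝ (Fin n → ℝ))

theorem scaled_apply {n : ℕ} (p : Equiv.Perm (Fin n)) (e : Fin n → ℕ) (k : Fin n)
    (x : Fin n → ℝ) : scaled p e k x = x (p k) / 2 ^ e k := by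
  simp [scaled, div_eq_inv_mul]

theorem apply_eq_scaled {n : ℕ} (p : Equiv.Perm (Fin n)) (e : Fin n → ℕ) (i : Fin n)
    (x : Fin n → ℝ) : x i = 2 ^ e (p.symm i) * scaled p e (p.symm i) x := by
  rw [scaled_apply, Equiv.apply_symm_apply]
  field_simp

/-- The simplex `1 ≤ x_{p(1)} / 2 ^ e_1 ≤ ⋯ ≤ x_{p(n)} / 2 ^ e_n ≤ 2`. -/
def alcove {n : ℕ} (p : Equiv.Perm (Fin n)) (e : Fin n → ℕ) : Set (Fin n → ℝ) :=
  {x | (∀ k, 1 ≤ scaled p e k x) ∧ (∀ k l, k ≤ l → scaled p e k x ≤ scaled p e l x) ∧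
    ∀ k, scaled p e k x ≤ 2}

/-- The linear forms in the inequalities that define an alcove. -/
noncomputable def wallForm {n : ℕ} (p : Equiv.Perm (Fin n)) (e : Fin n → ℕ) :
    Fin n ⊕ {q : Fin n × Fin n // q.1 ≤ q.2} ⊕ Fin n → StrongDual ℝ (Fin n → ℝ)
  | .inl k => scaled p e k
  | .inr (.inl q) => scaled p e q.1.2 - scaled p e q.1.1
  | .inr (.inr k) => -scaled p e k

/-- The bounds in the inequalities that define an alcove. -/
def wallBound {n : ℕ} : Fin n ⊕ {q : Fin n × Fin n // q.1 ≤ q.2} ⊕ Fin n → ℝ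
  | .inl _ => 1
  | .inr (.inl _) => 0
  | .inr (.inr _) => -2

theorem alcove_eq_setOf_wall {n : ℕ} (p : Equiv.Perm (Fin n)) (e : Fin n → ℕ) :
    alcove p e = {x | ∀ i, wallBound i ≤ wallForm p e i x} := by
  ext x
  simp [alcove, wallBound, wallForm, Sum.forall]

theorem convex_alcove {n : ℕ} (p : Equiv.Perm (Fin n)) (e : Fin n → ℕ) :
    Convex ℝ (alcove p e) := by
  rw [alcove_eq_setOf_wall, Set.ofPred_forall]
  exact convex_iInter fun i => convex_halfSpace_ge (wallForm p e i).toLinearMap.isLinear _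

theorem isClosed_alcove {n : ℕ} (p : Equiv.Perm (Fin n)) (e : Fin n → ℕ) :
    IsClosed (alcove p e) := by
  rw [alcove_eq_setOf_wall, Set.ofPred_forall]
  exact isClosed_iInter fun i => isClosed_le continuous_const (wallForm p e i).continuous

/-! ### Intersections of alcoves -/

/-- A convex subset of a polyhedron that is determined by the inequalities that are tight at a
point is an exposed face. -/
theorem isExposed_of_tight {E ι : Type*} [NormedAddCommGroup E] [NormedSpace ℝ E] [Finite ι]
    (f : ι → StrongDual ℝ E) (b : ι → ℝ) {B : Set E} (hB : Convex ℝ B)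
    (hsub : ∀ x ∈ B, ∀ i, b i ≤ f i x)
    (h : ∀ z ∈ B, ∀ x, (∀ i, b i ≤ f i x) → (∀ i, f i z = b i → f i x = b i) → x ∈ B) :
    IsExposed ℝ {x | ∀ i, b i ≤ f i x} B := by
  classical
  have := Fintype.ofFinite ι
  intro hne
  let tight : E → Finset ι := fun z => Finset.univ.filter fun i => f i z = b i
  have mem_tight : ∀ z i, i ∈ tight z ↔ f i z = b i := fun z i => by simp [tight]
  -- A point of `B` with the fewest tight inequalities plays the role of a relative interior point:
  -- the midpoint of `z` and `w` is tight only where both are, so by minimality everything tight at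
  -- `z` is tight on all of `B`.
  obtain ⟨z, hz, hmin⟩ : ∃ z ∈ B, ∀ w ∈ B, (tight z).card ≤ (tight w).card := by
    obtain ⟨z, hz⟩ := hne
    have hex : ∃ m, ∃ z ∈ B, (tight z).card = m := ⟨_, z, hz, rfl⟩
    obtain ⟨z, hz, hzm⟩ := Nat.find_spec hex
    exact ⟨z, hz, fun w hw => hzm ▸ Nat.find_min' hex ⟨w, hw, rfl⟩⟩
  have hall : ∀ w ∈ B, ∀ i ∈ tight z, f i w = b i := by
    intro w hw i hi
    by_contra hwi
    have hm : (1 / 2 : ℝ) • z + (1 / 2 : ℝ) • w ∈ B :=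
      hB hz hw (by norm_num) (by norm_num) (by norm_num)
    have hss : tight ((1 / 2 : ℝ) • z + (1 / 2 : ℝ) • w) ⊂ tight z := by
      rw [Finset.ssubset_iff_of_subset]
      · refine ⟨i, hi, fun hi' => hwi ?_⟩
        rw [mem_tight] at hi hi'
        simp only [map_add, map_smul, smul_eq_mul] at hi'
        linarith
      · intro j hj
        rw [mem_tight] at hj ⊢
        simp only [map_add, map_smul, smul_eq_mul] at hj
        have h1 := hsub z hz j
        have h2 := hsub w hw j
        linarith
    exact absurd (hmin _ hm) (not_le.mpr (Finset.card_lt_card hss))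
  -- On the polyhedron this sum is largest exactly where all inequalities tight at `z` are tight.
  refine ⟨-∑ i ∈ tight z, f i, ?_⟩
  have happ : ∀ x, (-∑ i ∈ tight z, f i) x = -∑ i ∈ tight z, f i x := fun x => by simp
  ext x
  simp only [Set.mem_ofPred_eq, happ, neg_le_neg_iff]
  constructor
  · intro hx
    refine ⟨hsub x hx, fun y hy => ?_⟩
    rw [Finset.sum_congr rfl fun i hi => hall x hx i hi]
    exact Finset.sum_le_sum fun i _ => hy i
  · rintro ⟨hx, hmax⟩
    refine h z hz x hx fun i hi => ?_
    have h1 := hmax z (hsub z hz)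
    rw [Finset.sum_congr rfl fun i hi => hall z hz i hi] at h1
    have h2 := (Finset.sum_eq_sum_iff_of_le fun i (_ : i ∈ tight z) => hx i).mp
      (le_antisymm (Finset.sum_le_sum fun i _ => hx i) h1)
    exact (h2 i ((mem_tight z i).mpr hi)).symm

/-- An inequality of one alcove, read in the scaled coordinates of another, compares `2 ^ M * u`
with `2 ^ N * v` where `u, v ∈ [1, 2]`. For `M < N` it always holds, for `M = N` it is `u ≤ v`, and
for `M > N` it forces `M = N + 1`, `u = 1`, `v = 2`. So its truth passes to every point at which the
same walls are tight. -/
theorem pow_mul_le_pow_mul_of_tight {M N : ℕ} {u v u' v' : ℝ} (hu : 1 ≤ u) (hv : v ≤ 2)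
    (hu2 : u' ≤ 2) (hv' : 1 ≤ v')
    (h : 2 ^ M * u ≤ 2 ^ N * v) (heq : u ≤ v → u' ≤ v') (h1 : u = 1 → u' = 1)
    (h2 : v = 2 → v' = 2) : 2 ^ M * u' ≤ 2 ^ N * v' := by
  rcases lt_trichotomy M N with hMN | rfl | hMN
  · calc (2 : ℝ) ^ M * u' ≤ 2 ^ (M + 1) * 1 := by
          rw [pow_succ, mul_assoc]
          gcongr
          linarith
      _ ≤ 2 ^ N * v' := by
          gcongr
          · norm_num
          · omega
  · have := heq (le_of_mul_le_mul_left h (by positivity))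
    gcongr
  · obtain ⟨d, rfl⟩ := Nat.exists_eq_add_of_lt hMN
    have hd : (1 : ℝ) ≤ 2 ^ d := one_le_pow₀ (by norm_num)
    have hN : (0 : ℝ) < 2 ^ N := by positivity
    have h' : 2 ^ d * 2 * u ≤ v := by
      refine le_of_mul_le_mul_left ?_ hN
      calc (2 : ℝ) ^ N * (2 ^ d * 2 * u) = 2 ^ (N + d + 1) * u := by ring
        _ ≤ _ := h
    have h3 : 2 ^ d * 2 * 1 ≤ 2 ^ d * 2 * u := by gcongr
    have hd1 : (2 : ℝ) ^ d = 1 := by linarith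
    have hu1 : u = 1 := by rw [hd1] at h'; linarith
    have hv1 : v = 2 := by rw [hd1] at h'; linarith
    rw [h1 hu1, h2 hv1]
    have : (2 : ℝ) ^ (N + d + 1) * 1 = 2 ^ N * 2 * 2 ^ d := by ring
    rw [this, hd1, mul_one]

theorem isExposed_alcove_inter {n : ℕ} (p p' : Equiv.Perm (Fin n)) (e e' : Fin n → ℕ) :
    IsExposed ℝ (alcove p e) (alcove p e ∩ alcove p' e') := by
  have hA := alcove_eq_setOf_wall p e
  suffices IsExposed ℝ {x | ∀ i, wallBound i ≤ wallForm p e i x} (alcove p e ∩ alcove p' e') by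
    rwa [← hA] at this
  refine isExposed_of_tight _ _ ((convex_alcove p e).inter (convex_alcove p' e'))
    (fun x hx => by have := hx.1; rwa [hA] at this) ?_
  rintro z ⟨hz, hz'⟩ x hx ht
  replace hx : x ∈ alcove p e := by rw [hA]; exact hx
  refine ⟨hx, ?_⟩
  have t1 : ∀ k, scaled p e k z = 1 → scaled p e k x = 1 := fun k => ht (.inl k)
  have t2 : ∀ k, scaled p e k z = 2 → scaled p e k x = 2 := fun k hk => by
    have := ht (.inr (.inr k))
    simp only [wallForm, wallBound, neg_apply, neg_inj] at this
    exact this hk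
  have t3 : ∀ k l, scaled p e k z ≤ scaled p e l z → scaled p e k x ≤ scaled p e l x := by
    intro k l hkl
    rcases le_total k l with h | h
    · exact hx.2.1 k l h
    · have := ht (.inr (.inl ⟨(l, k), h⟩))
      simp only [wallForm, wallBound, sub_apply, sub_eq_zero] at this
      exact (this (le_antisymm hkl (hz.2.1 l k h))).le
  refine ⟨fun k => ?_, fun k l hkl => ?_, fun k => ?_⟩
  · have h := hz'.1 k
    rw [scaled_apply, one_le_div (by positivity)] at h ⊢
    rw [apply_eq_scaled p e (p' k) z] at h
    rw [apply_eq_scaled p e (p' k) x]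
    -- The constant bound is treated as a scaled coordinate that stays equal to `1`; for the upper
    -- bound below, one that stays equal to `2`.
    have := pow_mul_le_pow_mul_of_tight (u := 1) (u' := 1) le_rfl (hz.2.2 _) one_le_two
      (hx.1 _) (by rwa [mul_one]) (fun _ => hx.1 _) (fun _ => rfl) (t2 _)
    rwa [mul_one] at this
  · have h := hz'.2.1 k l hkl
    rw [scaled_apply, scaled_apply, div_le_div_iff₀ (by positivity) (by positivity)] at h ⊢
    rw [apply_eq_scaled p e (p' k) z, apply_eq_scaled p e (p' l) z] at h
    rw [apply_eq_scaled p e (p' k) x, apply_eq_scaled p e (p' l) x]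
    rw [mul_right_comm, mul_right_comm _ _ ((2 : ℝ) ^ e' k), ← pow_add, ← pow_add] at h ⊢
    exact pow_mul_le_pow_mul_of_tight (hz.1 _) (hz.2.2 _) (hx.2.2 _) (hx.1 _) h (t3 _ _) (t1 _)
      (t2 _)
  · have h := hz'.2.2 k
    rw [scaled_apply, div_le_iff₀' (by positivity)] at h ⊢
    rw [apply_eq_scaled p e (p' k) z] at h
    rw [apply_eq_scaled p e (p' k) x]
    exact pow_mul_le_pow_mul_of_tight (v := 2) (v' := 2) (hz.1 _) le_rfl (hx.2.2 _)
      one_le_two h (fun _ => hx.2.2 _) (t1 _) (fun _ => rfl)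

/-! ### Orthoschemes -/

/-- The vertices of the path simplex. -/
def pathVertex {n : ℕ} (ℓ : Fin n → ℝ) (m : Fin (n + 1)) (i : Fin n) : ℝ :=
  if (i : ℕ) < m then ℓ i else 0

theorem pathSimplex_eq_convexHull {n : ℕ} (ℓ : Fin n → ℝ) :
    pathSimplex ℓ = convexHull ℝ (Set.range (pathVertex ℓ)) := rfl

theorem sum_range_ite_telescope (τ : ℕ → ℝ) (i N : ℕ) :
    ∑ m ∈ Finset.range N, (if i < m then τ m - τ (m + 1) else 0) =
      if i < N then τ (i + 1) - τ N else 0 := by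
  induction N with
  | zero => simp
  | succ N ih =>
    rw [Finset.sum_range_succ, ih]
    rcases lt_trichotomy i N with h | rfl | h
    · simp [h, Nat.lt_succ_of_lt h]
    · simp
    · have h1 : ¬ i < N := by omega
      have h2 : ¬ i < N + 1 := by omega
      simp [h1, h2]

theorem mem_pathSimplex_iff {n : ℕ} {ℓ : Fin n → ℝ} (hℓ : ∀ i, 0 < ℓ i) (y : Fin n → ℝ) :
    y ∈ pathSimplex ℓ ↔ (∀ i, 0 ≤ y i / ℓ i) ∧ (∀ i j, i ≤ j → y j / ℓ j ≤ y i / ℓ i) ∧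
      ∀ i, y i / ℓ i ≤ 1 := by
  constructor
  · suffices pathSimplex ℓ ⊆ {y | (∀ i, 0 ≤ y i / ℓ i) ∧
        (∀ i j, i ≤ j → y j / ℓ j ≤ y i / ℓ i) ∧ ∀ i, y i / ℓ i ≤ 1} from fun h => this h
    refine convexHull_min ?_ ?_
    · rintro _ ⟨m, rfl⟩
      have hval : ∀ i : Fin n, (if (i : ℕ) < m then ℓ i else 0) / ℓ i =
          if (i : ℕ) < m then 1 else 0 := by
        intro i
        split_ifs
        · exact div_self (hℓ i).ne'
        · exact zero_div _
      simp only [Set.mem_ofPred_eq, hval]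
      refine ⟨fun i => by split_ifs <;> simp, fun i j hij => ?_, fun i => by split_ifs <;> simp⟩
      have : (i : ℕ) ≤ j := hij
      split_ifs <;> first | omega | simp
    · intro x hx z hz a b ha hb hab
      have hval : ∀ i, (a • x + b • z) i / ℓ i = a * (x i / ℓ i) + b * (z i / ℓ i) := by
        intro i
        simp only [Pi.add_apply, Pi.smul_apply, smul_eq_mul]
        ring
      simp only [Set.mem_ofPred_eq, hval] at hx hz ⊢
      refine ⟨fun i => ?_, fun i j hij => ?_, fun i => ?_⟩
      · have := hx.1 i
        have := hz.1 i
        positivity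
      · have := hx.2.1 i j hij
        have := hz.2.1 i j hij
        gcongr
      · calc a * (x i / ℓ i) + b * (z i / ℓ i) ≤ a * 1 + b * 1 := by
              have := hx.2.2 i
              have := hz.2.2 i
              gcongr
          _ = 1 := by rw [mul_one, mul_one, hab]
  · rintro ⟨h0, hanti, h1⟩
    -- The ratios `y i / ℓ i`, shifted by one and bordered by `1` in front and `0` at the end; their
    -- consecutive differences are the barycentric coordinates of `y`.
    let τ : ℕ → ℝ := fun m => if m = 0 then 1 else
      if h : m - 1 < n then y ⟨m - 1, h⟩ / ℓ ⟨m - 1, h⟩ else 0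
    have τ0 : τ 0 = 1 := by simp [τ]
    have τs : ∀ i : Fin n, τ (i + 1) = y i / ℓ i := fun i => by simp [τ]
    have τn : τ (n + 1) = 0 := by simp [τ]
    refine mem_convexHull_of_exists_fintype (fun m : Fin (n + 1) => τ m - τ (m + 1))
      (pathVertex ℓ) ?_ ?_ (fun m => ⟨m, rfl⟩) ?_
    · intro m
      rw [sub_nonneg]
      rcases Nat.eq_zero_or_pos m with hm | hm
      · rw [hm, τ0]
        rcases Nat.eq_zero_or_pos n with rfl | hn
        · simp [τ]
        · simpa using (τs ⟨0, hn⟩).le.trans (h1 _)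
      · obtain ⟨k, hk⟩ : ∃ k, (m : ℕ) = k + 1 := ⟨m - 1, by omega⟩
        have hkn : k < n := by omega
        rw [hk, τs ⟨k, hkn⟩]
        rcases Nat.lt_or_ge (k + 1) n with h | h
        · rw [τs ⟨k + 1, h⟩]
          exact hanti _ _ (by simp)
        · rw [show k + 1 + 1 = n + 1 by omega, τn]
          exact h0 _
    · rw [Fin.sum_univ_eq_sum_range (fun m => τ m - τ (m + 1)), Finset.sum_range_sub', τ0, τn,
        sub_zero]
    · ext i
      rw [Finset.sum_apply]
      have : ∀ m : Fin (n + 1), ((τ m - τ (m + 1)) • pathVertex ℓ m) i =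
          (fun m : ℕ => if (i : ℕ) < m then τ m - τ (m + 1) else 0) m * ℓ i := by
        intro m
        simp only [Pi.smul_apply, pathVertex, smul_eq_mul]
        split_ifs <;> simp
      rw [Finset.sum_congr rfl fun m _ => this m, ← Finset.sum_mul,
        Fin.sum_univ_eq_sum_range (fun m : ℕ => if (i : ℕ) < m then τ m - τ (m + 1) else 0),
        sum_range_ite_telescope, if_pos (by omega), τn, τs, sub_zero, div_mul_cancel₀ _ (hℓ i).ne']

/-- The coordinate `j` of a vanishing combination says that the weights of the vertices beyond `j`
sum to zero. Each weight is a difference of two consecutive such tail sums; the full sum vanishes by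
assumption and the tail beyond the last vertex is empty. -/
theorem affineIndependent_pathVertex {n : ℕ} {ℓ : Fin n → ℝ} (hℓ : ∀ i, 0 < ℓ i) :
    AffineIndependent ℝ (pathVertex ℓ) := by
  classical
  rw [affineIndependent_iff]
  intro s w hw hsum m hm
  have hcoord : ∀ j : ℕ, j < n → ∑ k ∈ s, (if j < (k : ℕ) then w k else 0) = 0 := by
    intro j hj
    have := congrFun hsum ⟨j, hj⟩
    rw [Finset.sum_apply] at this
    have h2 : ∀ k ∈ s, (w k • pathVertex ℓ k) ⟨j, hj⟩ =
        (if j < (k : ℕ) then w k else 0) * ℓ ⟨j, hj⟩ := by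
      intro k _
      simp only [Pi.smul_apply, pathVertex, smul_eq_mul]
      split_ifs <;> simp
    rw [Finset.sum_congr rfl h2, ← Finset.sum_mul, Pi.zero_apply] at this
    exact (mul_eq_zero.mp this).resolve_right (hℓ _).ne'
  have hgt : ∑ k ∈ s, (if (m : ℕ) < (k : ℕ) then w k else 0) = 0 := by
    rcases Nat.lt_or_ge m n with h | h
    · exact hcoord m h
    · exact Finset.sum_eq_zero fun k _ => if_neg (by omega)
  have hge : ∑ k ∈ s, (if (m : ℕ) ≤ (k : ℕ) then w k else 0) = 0 := by
    rcases Nat.eq_zero_or_pos m with h | h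
    · simpa [h] using hw
    · refine (Finset.sum_congr rfl fun k _ => ?_).trans (hcoord (m - 1) (by omega))
      exact if_congr (by omega) rfl rfl
  have hsub : ∑ k ∈ s, (if k = m then w k else 0) = 0 := by
    refine Eq.trans ?_ ((congrArg₂ (· - ·) hge hgt).trans (sub_zero _))
    rw [← Finset.sum_sub_distrib]
    refine Finset.sum_congr rfl fun k _ => ?_
    rcases lt_trichotomy k m with h | rfl | h
    · have h' : (k : ℕ) < m := h
      simp [h.ne, h'.not_ge, h'.le.not_gt]
    · simp
    · have h' : (m : ℕ) < k := h
      simp [h.ne', h', h.le]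
  simpa [Finset.sum_ite_eq', hm] using hsub

theorem IsOrthoscheme.isSimplex {n : ℕ} {ℓ : Fin n → ℝ} {S : Set (Fin n → ℝ)}
    (h : IsOrthoscheme ℓ S) : IsSimplex S := by
  obtain ⟨hℓ, σ, a, rfl⟩ := h
  let F : (Fin n → ℝ) →ᵃ[ℝ] (Fin n → ℝ) :=
    AffineMap.const ℝ (Fin n → ℝ) a + (LinearMap.funLeft ℝ ℝ σ).toAffineMap
  have hF : (F : (Fin n → ℝ) → Fin n → ℝ) = fun y i => a i + y (σ i) := by
    ext y i
    simp [F, LinearMap.funLeft]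
  have hinj : Function.Injective F := by
    rw [hF]
    intro y z hyz
    ext i
    have := congrFun hyz (σ.symm i)
    simpa using this
  refine ⟨F ∘ pathVertex ℓ, (affineIndependent_pathVertex hℓ).map' F hinj, ?_⟩
  rw [← hF, pathSimplex_eq_convexHull, AffineMap.image_convexHull, Set.range_comp]

theorem isOrthoscheme_alcove {n : ℕ} (p : Equiv.Perm (Fin n)) (e : Fin n → ℕ) :
    IsOrthoscheme (fun m : Fin n => (2 : ℝ) ^ e m.rev) (alcove p e) := by
  have hpos : ∀ i : Fin n, (0 : ℝ) < 2 ^ e i.rev := fun i => by positivity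
  -- The translation moves the origin to the vertex where all scaled coordinates are `1`. The order
  -- is reversed because the ratios decrease on a path simplex and increase on an alcove.
  refine ⟨hpos, p.symm.trans Fin.revPerm, fun i => 2 ^ e (p.symm i), ?_⟩
  have hval : ∀ (x : Fin n → ℝ) k, (x (p k) - 2 ^ e k) / 2 ^ e k = scaled p e k x - 1 := by
    intro x k
    rw [scaled_apply, sub_div, div_self (by positivity)]
  ext x
  constructor
  · rintro ⟨h1, h2, h3⟩
    refine ⟨fun m => x (p m.rev) - 2 ^ e m.rev, ?_, ?_⟩
    · rw [mem_pathSimplex_iff hpos]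
      simp only [hval]
      refine ⟨fun i => ?_, fun i j hij => ?_, fun i => ?_⟩
      · linarith [h1 i.rev]
      · linarith [h2 j.rev i.rev (Fin.rev_le_rev.mpr hij)]
      · linarith [h3 i.rev]
    · ext i
      simp
  · rintro ⟨y, hy, rfl⟩
    rw [mem_pathSimplex_iff hpos] at hy
    have hs : ∀ k, scaled p e k (fun i => 2 ^ e (p.symm i) +
        y ((p.symm.trans Fin.revPerm) i)) = 1 + y k.rev / 2 ^ e k := by
      intro k
      rw [scaled_apply]
      simp [add_div]
    have hrev : ∀ k : Fin n, k.rev.rev = k := Fin.rev_rev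
    refine ⟨fun k => ?_, fun k l hkl => ?_, fun k => ?_⟩
    · rw [hs]
      have := hy.1 k.rev
      rw [hrev] at this
      linarith
    · rw [hs, hs]
      have := hy.2.1 l.rev k.rev (Fin.rev_le_rev.mpr hkl)
      rw [hrev, hrev] at this
      linarith
    · rw [hs]
      have := hy.2.2 k.rev
      rw [hrev] at this
      linarith

/-! ### Volumes -/

open MeasureTheory

theorem volume_hyperplane {n : ℕ} (f : StrongDual ℝ (Fin n → ℝ)) (hf : f ≠ 0) (r : ℝ) :
    volume {x | f x = r} = 0 := by
  let H : AffineSubspace ℝ (Fin n → ℝ) :=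
    { carrier := {x | f x = r}
      smul_vsub_vadd_mem' := by
        intro c x y z hx hy hz
        simp only [Set.mem_ofPred_eq] at hx hy hz ⊢
        simp [hx, hy, hz] }
  refine Measure.addHaar_affineSubspace volume H fun htop => hf ?_
  have hall : ∀ x, f x = r := fun x => by
    have : x ∈ H := htop ▸ AffineSubspace.mem_top ℝ _ x
    exact this
  ext x
  have := hall 0
  rw [map_zero] at this
  simp [hall, ← this]

/-- If the exponents of some coordinate differ, that coordinate is a fixed power of two on the
intersection. Otherwise two coordinates are ordered oppositely, so their scaled values agree. Either
way the intersection lies in a hyperplane. -/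
theorem volume_alcove_inter {n : ℕ} {p p' : Equiv.Perm (Fin n)} {e e' : Fin n → ℕ}
    (h : ¬ (p = p' ∧ e = e')) : volume (alcove p e ∩ alcove p' e') = 0 := by
  have hpow : ∀ (a b : ℕ) (u : ℝ), a < b → u ≤ 2 ^ (a + 1) → 2 ^ b ≤ u →
      u = 2 ^ b := by
    intro a b u hab h1 h2
    refine le_antisymm (h1.trans ?_) h2
    exact pow_le_pow_right₀ one_le_two hab
  have hlow : ∀ (p : Equiv.Perm (Fin n)) (e : Fin n → ℕ) x i, x ∈ alcove p e →
      2 ^ e (p.symm i) ≤ x i := by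
    intro p e x i hx
    have := hx.1 (p.symm i)
    rwa [scaled_apply, one_le_div (by positivity), Equiv.apply_symm_apply] at this
  have hup : ∀ (p : Equiv.Perm (Fin n)) (e : Fin n → ℕ) x i, x ∈ alcove p e →
      x i ≤ 2 ^ (e (p.symm i) + 1) := by
    intro p e x i hx
    have := hx.2.2 (p.symm i)
    rwa [scaled_apply, div_le_iff₀ (by positivity), Equiv.apply_symm_apply, ← pow_succ'] at this
  by_cases hE : ∀ i, e (p.symm i) = e' (p'.symm i)
  · have hp : p ≠ p' := fun hp => h ⟨hp, funext fun k => by simpa [hp] using hE (p k)⟩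
    obtain ⟨i, j, hij, hji⟩ : ∃ i j, p.symm i < p.symm j ∧ p'.symm j < p'.symm i := by
      by_contra hcon
      push Not at hcon
      -- Without an inversion the comparison of the two orders is a strictly monotone self-map of
      -- `Fin n`, hence the identity.
      have hmono : StrictMono (fun k => p'.symm (p k)) := by
        intro k l hkl
        refine lt_of_le_of_ne (hcon _ _ (by simpa using hkl)) fun heq => ?_
        exact hkl.ne (by simpa using heq)
      have hid : (fun k => p'.symm (p k)) = id := le_antisymm hmono.le_id hmono.id_le
      exact hp (Equiv.ext fun k => by
        have := congrFun hid k
        simpa [Equiv.symm_apply_eq] using this)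
    refine measure_mono_null (t := {x | (scaled p e (p.symm i) - scaled p e (p.symm j)) x = 0})
      ?_ (volume_hyperplane _ ?_ 0)
    · rintro x ⟨hx, hx'⟩
      have h1 := hx.2.1 _ _ hij.le
      have h2 := hx'.2.1 _ _ hji.le
      simp only [scaled_apply, Equiv.apply_symm_apply, ← hE] at h1 h2
      simp only [Set.mem_ofPred_eq, sub_apply, scaled_apply,
        Equiv.apply_symm_apply]
      linarith
    · intro h0
      have hne : j ≠ i := fun h => by simp [h] at hij
      have := DFunLike.congr_fun h0 (Pi.single i 1)
      simp [scaled_apply, hne] at this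
  · push Not at hE
    obtain ⟨i, hi⟩ := hE
    refine measure_mono_null (t := {x | (ContinuousLinearMap.proj i :
      StrongDual ℝ (Fin n → ℝ)) x = 2 ^ max (e (p.symm i)) (e' (p'.symm i))}) ?_
      (volume_hyperplane _ ?_ _)
    · rintro x ⟨hx, hx'⟩
      simp only [Set.mem_ofPred_eq, ContinuousLinearMap.proj_apply]
      rcases lt_or_gt_of_ne hi with hlt | hlt
      · rw [max_eq_right hlt.le]
        exact hpow _ _ _ hlt (hup _ _ _ _ hx) (hlow _ _ _ _ hx')
      · rw [max_eq_left hlt.le]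
        exact hpow _ _ _ hlt (hup _ _ _ _ hx') (hlow _ _ _ _ hx)
    · intro h0
      have := DFunLike.congr_fun h0 (Pi.single i 1)
      simp at this

theorem volume_alcove_eq_one {n : ℕ} (p : Equiv.Perm (Fin n)) (e : Fin n → ℕ) :
    volume (alcove p e) = volume (alcove 1 e) := by
  have hmp := volume_measurePreserving_piCongrLeft (fun _ : Fin n => ℝ) p
  rw [← hmp.measure_preimage (isClosed_alcove p e).measurableSet.nullMeasurableSet]
  congr 1
  ext x
  simp [alcove, scaled_apply, MeasurableEquiv.piCongrLeft, Equiv.piCongrLeft_apply]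

/-- The alcoves with zero exponents, one per permutation and all of the same volume, fill the unit
cube `[1, 2]^n` up to null overlaps. -/
theorem volume_alcove_zero {n : ℕ} :
    (n ! : ℝ≥0∞) * volume (alcove (1 : Equiv.Perm (Fin n)) 0) = 1 := by
  have hcube : ⋃ p : Equiv.Perm (Fin n), alcove p 0 = Set.Icc (fun _ => 1) (fun _ => 2) := by
    ext x
    simp only [Set.mem_iUnion, Set.mem_Icc, Pi.le_def]
    constructor
    · rintro ⟨p, h1, -, h2⟩
      simp only [scaled_apply, Pi.zero_apply, pow_zero, div_one] at h1 h2
      exact ⟨fun i => by simpa using h1 (p.symm i), fun i => by simpa using h2 (p.symm i)⟩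
    · rintro ⟨h1, h2⟩
      refine ⟨Tuple.sort x, ?_⟩
      simp only [alcove, scaled_apply, Pi.zero_apply, pow_zero, div_one, Set.mem_ofPred_eq]
      exact ⟨fun k => h1 _, fun k l hkl => Tuple.monotone_sort x hkl, fun k => h2 _⟩
  have hvol : volume (⋃ p : Equiv.Perm (Fin n), alcove p 0) = 1 := by
    rw [hcube, Real.volume_Icc_pi]
    norm_num
  rw [measure_iUnion₀ (fun p q hpq => volume_alcove_inter fun h => hpq h.1)
    (fun p => (isClosed_alcove p 0).measurableSet.nullMeasurableSet), tsum_fintype,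
    Finset.sum_congr rfl fun p _ => volume_alcove_eq_one p 0, Finset.sum_const,
    Finset.card_univ, Fintype.card_perm, Fintype.card_fin, nsmul_eq_mul] at hvol
  exact hvol

theorem volume_alcove {n : ℕ} (p : Equiv.Perm (Fin n)) (e : Fin n → ℕ) :
    (n ! : ℝ≥0∞) * volume (alcove p e) = 2 ^ ∑ k, e k := by
  let D := Matrix.toLin' (Matrix.diagonal fun k => ((2 : ℝ) ^ e k)⁻¹)
  have hdet : LinearMap.det D = ((2 : ℝ) ^ ∑ k, e k)⁻¹ := by
    rw [LinearMap.det_toLin', Matrix.det_diagonal, Finset.prod_inv_distrib,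
      Finset.prod_pow_eq_pow_sum]
  have hpre : alcove 1 e = D ⁻¹' alcove 1 0 := by
    ext x
    simp [alcove, scaled_apply, D, Matrix.mulVec_diagonal, div_eq_inv_mul]
  rw [volume_alcove_eq_one, hpre, Measure.addHaar_preimage_linearMap _
    (by rw [hdet]; positivity), mul_left_comm, volume_alcove_zero, hdet, mul_one, inv_inv,
    abs_of_pos (by positivity), ENNReal.ofReal_pow (by norm_num)]
  norm_num

theorem disjoint_interior_alcove {n : ℕ} {p p' : Equiv.Perm (Fin n)} {e e' : Fin n → ℕ}
    (h : ¬ (p = p' ∧ e = e')) : Disjoint (interior (alcove p e)) (interior (alcove p' e')) := by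
  rw [Set.disjoint_iff_inter_eq_empty]
  by_contra hne
  have hpos := (isOpen_interior.inter isOpen_interior).measure_pos volume
    (Set.nonempty_iff_ne_empty.mpr hne)
  exact hpos.ne' (measure_mono_null
    (Set.inter_subset_inter interior_subset interior_subset) (volume_alcove_inter h))

/-! ### Searches

A neighbors-first search is determined by the lists of nodes that are visited in its steps. We
record the nodes `R w` that are pending below the node `w` while `w` is pending. -/

/-- A step of a search in which the active node `a` has the newly visited neighbors `c`. -/
inductive Step {n : ℕ} (R : Fin (n + 1) → Finset (Fin (n + 1))) : NFSState n → NFSState n → Prop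
  | mk {vis rest c : List (Fin (n + 1))} {edg : List (Fin (n + 1) × Fin (n + 1))}
      {a : Fin (n + 1)} (sorted : c.Pairwise (· > ·)) (notMem : ∀ w ∈ c, w ∉ vis)
      (below : ∀ w ∈ c, R w = rest.toFinset ∪ c.toFinset.filter (w < ·)) :
      Step R ⟨vis, a :: rest, edg⟩ ⟨vis ++ c, c.reverse ++ rest, edg ++ c.map fun w => (a, w)⟩

/-- The states of searches that begin at the root. -/
inductive Run {n : ℕ} (R : Fin (n + 1) → Finset (Fin (n + 1))) : NFSState n → Prop
  | init (root : R (Fin.last n) = ∅) : Run R (nfsInit n)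
  | step {s s' : NFSState n} : Run R s → Step R s s' → Run R s'

/-- The states that can be reached from a given one. -/
abbrev Reach {n : ℕ} (R : Fin (n + 1) → Finset (Fin (n + 1))) :
    NFSState n → NFSState n → Prop :=
  Relation.ReflTransGen (Step R)

theorem Run.reach {n : ℕ} {R : Fin (n + 1) → Finset (Fin (n + 1))} {s : NFSState n}
    (h : Run R s) : Reach R (nfsInit n) s := by
  induction h with
  | init root => exact .refl
  | step _ h ih => exact ih.tail h

theorem Run.root {n : ℕ} {R : Fin (n + 1) → Finset (Fin (n + 1))} {s : NFSState n}
    (h : Run R s) : R (Fin.last n) = ∅ := by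
  induction h with
  | init root => exact root
  | step _ _ ih => exact ih

theorem nodup_of_sorted {m : ℕ} {c : List (Fin m)} (h : c.Pairwise (· > ·)) : c.Nodup :=
  h.imp fun h => ne_of_gt h

theorem Run.exists_visited_eq_cons {n : ℕ} {R : Fin (n + 1) → Finset (Fin (n + 1))}
    {s : NFSState n} (h : Run R s) : ∃ t, s.visited = Fin.last n :: t := by
  induction h with
  | init root => exact ⟨[], rfl⟩
  | step _ h ih =>
    cases h with
    | mk => obtain ⟨t, ht⟩ := ih; exact ⟨t ++ _, by simp only at ht ⊢; rw [ht, List.cons_append]⟩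

theorem Run.lists {n : ℕ} {R : Fin (n + 1) → Finset (Fin (n + 1))} {s : NFSState n}
    (h : Run R s) : s.visited.Nodup ∧ s.pending.Nodup ∧ ∀ v ∈ s.pending, v ∈ s.visited := by
  induction h with
  | init root => simp [nfsInit]
  | step _ h ih =>
    cases h with
    | @mk vis rest c edg a₀ sorted notMem below =>
      obtain ⟨h1, h2, h3⟩ := ih
      have hc := nodup_of_sorted sorted
      simp only [List.nodup_cons, List.mem_cons] at h2 h3
      refine ⟨?_, ?_, ?_⟩
      · exact List.nodup_append.mpr ⟨h1, hc, fun a ha b hb hab => notMem b hb (hab ▸ ha)⟩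
      · refine List.nodup_append.mpr ⟨List.nodup_reverse.mpr hc, h2.2, fun a ha b hb hab => ?_⟩
        exact notMem a (List.mem_reverse.mp ha) (h3 a (Or.inr (hab ▸ hb)))
      · intro v hv
        rw [List.mem_append, List.mem_reverse] at hv
        exact List.mem_append.mpr (hv.elim .inr fun hv => .inl (h3 v (.inr hv)))

theorem Run.edge_mem {n : ℕ} {R : Fin (n + 1) → Finset (Fin (n + 1))} {s : NFSState n}
    (h : Run R s) {a w : Fin (n + 1)} (haw : (a, w) ∈ s.edges) :
    a ∈ s.visited ∧ a ∉ s.pending ∧ w ∈ s.visited := by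
  induction h with
  | init root => simp [nfsInit] at haw
  | step hr h ih =>
    have hl := hr.lists
    cases h with
    | @mk vis rest c edg a₀ sorted notMem below =>
      simp only [List.nodup_cons, List.mem_cons] at hl
      simp only [List.mem_append, List.mem_map, Prod.mk.injEq, List.mem_reverse] at haw ih ⊢
      rcases haw with haw | ⟨u, hu, rfl, rfl⟩
      · obtain ⟨h1, h2, h3⟩ := ih haw
        refine ⟨.inl h1, ?_, .inl h3⟩
        rintro (h | h)
        · exact notMem _ h h1
        · exact h2 (List.mem_cons_of_mem _ h)
      · refine ⟨.inl (hl.2.2 _ (.inl rfl)), ?_, .inr hu⟩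
        rintro (h | h)
        · exact notMem _ h (hl.2.2 _ (.inl rfl))
        · exact hl.2.1.1 h

theorem idxOf_lt_idxOf_append {α : Type*} [DecidableEq α] {l c : List α} {a w : α} (ha : a ∈ l)
    (hw : w ∈ l → l.idxOf a < l.idxOf w) : (l ++ c).idxOf a < (l ++ c).idxOf w := by
  rw [List.idxOf_append_of_mem ha]
  by_cases h : w ∈ l
  · rw [List.idxOf_append_of_mem h]
    exact hw h
  · rw [List.idxOf_append_of_notMem h]
    have := List.idxOf_lt_length_of_mem ha
    omega

theorem Run.idxOf_edge_lt {n : ℕ} {R : Fin (n + 1) → Finset (Fin (n + 1))} {s : NFSState n}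
    (h : Run R s) {a w : Fin (n + 1)} (haw : (a, w) ∈ s.edges) :
    s.visited.idxOf a < s.visited.idxOf w := by
  induction h with
  | init root => simp [nfsInit] at haw
  | step hr h ih =>
    have hl := hr.lists
    have he := fun h => hr.edge_mem (a := a) (w := w) h
    cases h with
    | @mk vis rest c edg a₀ sorted notMem below =>
      simp only [List.mem_append, List.mem_map, Prod.mk.injEq] at haw
      rcases haw with haw | ⟨u, hu, rfl, rfl⟩
      · exact idxOf_lt_idxOf_append (he haw).1 fun _ => ih haw
      · exact idxOf_lt_idxOf_append (hl.2.2 _ List.mem_cons_self) fun h => absurd h (notMem _ hu)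

theorem Run.exists_edge {n : ℕ} {R : Fin (n + 1) → Finset (Fin (n + 1))} {s : NFSState n}
    (h : Run R s) {w : Fin (n + 1)} (hw : w ∈ s.visited) (hne : w ≠ Fin.last n) :
    ∃ a, (a, w) ∈ s.edges := by
  induction h with
  | init root => simp [nfsInit, hne] at hw
  | step hr h ih =>
    cases h with
    | @mk vis rest c edg a₀ sorted notMem below =>
      simp only [List.mem_append, List.mem_map, Prod.mk.injEq] at hw ⊢
      rcases hw with hw | hw
      · obtain ⟨a, ha⟩ := ih hw
        exact ⟨a, .inl ha⟩
      · exact ⟨_, .inr ⟨w, hw, rfl, rfl⟩⟩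

theorem Run.length_edges {n : ℕ} {R : Fin (n + 1) → Finset (Fin (n + 1))} {s : NFSState n}
    (h : Run R s) : s.edges.length + 1 = s.visited.length := by
  induction h with
  | init root => rfl
  | step hr h ih =>
    cases h with
    | mk =>
      simp only [List.length_append, List.length_map] at ih ⊢
      omega

/-- The nodes below each node of a list are those that `R` prescribes. -/
def IsStack {n : ℕ} (R : Fin (n + 1) → Finset (Fin (n + 1))) : List (Fin (n + 1)) → Prop
  | [] => True
  | a :: r => R a = r.toFinset ∧ IsStack R r

theorem isStack_append {n : ℕ} {R : Fin (n + 1) → Finset (Fin (n + 1))}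
    {l r : List (Fin (n + 1))} (hr : IsStack R r) (hl : l.Pairwise (· < ·))
    (h : ∀ w ∈ l, R w = r.toFinset ∪ l.toFinset.filter (w < ·)) : IsStack R (l ++ r) := by
  induction l with
  | nil => exact hr
  | cons w l ih =>
    rw [List.pairwise_cons] at hl
    refine ⟨?_, ih hl.2 fun u hu => ?_⟩
    · rw [h w List.mem_cons_self]
      ext b
      rw [List.append_eq, List.toFinset_append]
      simp only [Finset.mem_union, List.mem_toFinset, Finset.mem_filter, List.mem_cons]
      constructor
      · rintro (hb | ⟨rfl | hb, hlt⟩)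
        · exact .inr hb
        · exact absurd hlt (lt_irrefl _)
        · exact .inl hb
      · rintro (hb | hb)
        · exact .inr ⟨.inr hb, hl.1 b hb⟩
        · exact .inl hb
    · rw [h u (List.mem_cons_of_mem _ hu), List.toFinset_cons, Finset.filter_insert,
        if_neg (hl.1 u hu).not_gt]

theorem Run.isStack {n : ℕ} {R : Fin (n + 1) → Finset (Fin (n + 1))} {s : NFSState n}
    (h : Run R s) : IsStack R s.pending := by
  induction h with
  | init root => exact ⟨root, trivial⟩
  | step hr h ih =>
    cases h with
    | @mk vis rest c edg a₀ sorted notMem below =>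
      refine isStack_append ih.2 (List.pairwise_reverse.mpr sorted) fun w hw => ?_
      rw [below w (List.mem_reverse.mp hw), List.toFinset_reverse]

/-- When `a` becomes active it leaves the stack, exposing `R a`, and its children are put on top
with the larger ones deeper. This is the set version of the recursion for exponents. -/
theorem Run.mem_below_iff {n : ℕ} {R : Fin (n + 1) → Finset (Fin (n + 1))} {s : NFSState n}
    (h : Run R s) {a w : Fin (n + 1)} (haw : (a, w) ∈ s.edges) (b : Fin (n + 1)) :
    b ∈ R w ↔ b ∈ R a ∨ ((a, b) ∈ s.edges ∧ w < b) := by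
  induction h with
  | init root => simp [nfsInit] at haw
  | step hr h ih =>
    have he := fun {u v} => hr.edge_mem (a := u) (w := v)
    have hs := hr.isStack
    cases h with
    | @mk vis rest c edg a₀ sorted notMem below =>
      simp only [List.mem_append, List.mem_map, Prod.mk.injEq] at haw he ih ⊢
      rcases haw with haw | ⟨u, hu, rfl, rfl⟩
      · rw [ih haw]
        have hne : ∀ v, ¬ (v ∈ c ∧ a₀ = a ∧ v = b) := fun v h =>
          (he haw).2.1 (h.2.1 ▸ List.mem_cons_self)
        simp only [hne, exists_false, or_false]
      · rw [below _ hu, hs.1, Finset.mem_union, Finset.mem_filter, List.mem_toFinset,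
          List.mem_toFinset]
        refine or_congr Iff.rfl (and_congr_left fun _ => ?_)
        constructor
        · exact fun h => .inr ⟨b, h, rfl, rfl⟩
        · rintro (h | ⟨v, hv, -, rfl⟩)
          · exact absurd List.mem_cons_self (he h).2.1
          · exact hv

theorem idxOf_lt_idxOf_of_sorted {m : ℕ} {l : List (Fin m)} (h : l.Pairwise (· > ·))
    {b w : Fin m} (hb : b ∈ l) (hw : w ∈ l) (hlt : w < b) : l.idxOf b < l.idxOf w := by
  have hb' := List.idxOf_lt_length_of_mem hb
  have hw' := List.idxOf_lt_length_of_mem hw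
  by_contra hle
  rcases (not_lt.mp hle).lt_or_eq with hlt' | heq
  · have := List.pairwise_iff_getElem.mp h _ _ hw' hb' hlt'
    simp only [List.getElem_idxOf] at this
    exact absurd this hlt.not_gt
  · exact hlt.ne ((List.idxOf_inj hw).mp heq)

theorem Run.mem_below {n : ℕ} {R : Fin (n + 1) → Finset (Fin (n + 1))} {s : NFSState n}
    (h : Run R s) {b w : Fin (n + 1)} (hw : w ∈ s.visited) (hb : b ∈ R w) :
    b ∈ s.visited ∧ s.visited.idxOf b < s.visited.idxOf w := by
  induction h with
  | init root =>
    simp only [nfsInit, List.mem_singleton] at hw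
    simp [hw, root] at hb
  | step hr h ih =>
    have hl := hr.lists
    cases h with
    | @mk vis rest c edg a₀ sorted notMem below =>
      simp only [List.mem_append] at hw ih hl ⊢
      by_cases hwv : w ∈ vis
      · obtain ⟨h1, h2⟩ := ih hwv
        exact ⟨.inl h1, idxOf_lt_idxOf_append h1 fun _ => h2⟩
      · have hwc := hw.resolve_left hwv
        rw [below w hwc, Finset.mem_union, Finset.mem_filter, List.mem_toFinset,
          List.mem_toFinset] at hb
        rcases hb with hb | ⟨hb, hlt⟩
        · have hbv := hl.2.2 b (List.mem_cons_of_mem _ hb)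
          exact ⟨.inl hbv, idxOf_lt_idxOf_append hbv fun h => absurd h hwv⟩
        · refine ⟨.inr hb, ?_⟩
          rw [List.idxOf_append_of_notMem (notMem b hb), List.idxOf_append_of_notMem hwv]
          exact Nat.add_lt_add_left (idxOf_lt_idxOf_of_sorted sorted hb hwc hlt) _

/-- In a decreasing list, the larger siblings of the entry at index `i` are the `i` entries before
it. -/
theorem card_below_getElem {n : ℕ} {R : Fin (n + 1) → Finset (Fin (n + 1))}
    {rest l : List (Fin (n + 1))} (hrest : rest.Nodup) (sorted : l.Pairwise (· > ·))
    (hdisj : ∀ w ∈ l, w ∉ rest)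
    (below : ∀ w ∈ l, R w = rest.toFinset ∪ l.toFinset.filter (w < ·)) (i : ℕ)
    (hi : i < l.length) : (R l[i]).card = rest.length + i := by
  rw [below _ (List.getElem_mem hi), Finset.card_union_of_disjoint,
    List.toFinset_card_of_nodup hrest]
  · have h1 : l.toFinset.filter (l[i] < ·) = (l.take i).toFinset := by
      ext b
      simp only [Finset.mem_filter, List.mem_toFinset, List.mem_take_iff_getElem]
      rw [List.pairwise_iff_getElem] at sorted
      constructor
      · rintro ⟨hb, hlt⟩
        obtain ⟨j, hj, rfl⟩ := List.getElem_of_mem hb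
        refine ⟨j, ?_, rfl⟩
        by_contra hle
        rcases (show i ≤ j by omega).lt_or_eq with hlt' | rfl
        · exact absurd (sorted i j hi hj hlt') hlt.not_gt
        · exact lt_irrefl _ hlt
      · rintro ⟨j, hj, rfl⟩
        exact ⟨List.getElem_mem _, sorted j i _ hi (by omega)⟩
    rw [h1, List.toFinset_card_of_nodup ((nodup_of_sorted sorted).sublist (List.take_sublist i l)),
      List.length_take, min_eq_left hi.le]
  · rw [Finset.disjoint_left]
    intro b hb hb'
    rw [Finset.mem_filter, List.mem_toFinset] at hb'
    exact hdisj b hb'.1 (List.mem_toFinset.mp hb)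

theorem Run.card_below {n : ℕ} {R : Fin (n + 1) → Finset (Fin (n + 1))} {s : NFSState n}
    (h : Run R s) {a w : Fin (n + 1)} (haw : (a, w) ∈ s.edges) :
    (R w).card = (R a).card + {u | (a, u) ∈ s.edges ∧ w < u}.ncard := by
  classical
  have hfin : {u | (a, u) ∈ s.edges ∧ w < u}.Finite := Set.toFinite _
  rw [Set.ncard_eq_toFinset_card _ hfin, ← Finset.card_union_of_disjoint]
  · congr 1
    ext b
    simp [h.mem_below_iff haw]
  · rw [Finset.disjoint_left]
    intro b hb hb'
    have h1 := (h.mem_below (h.edge_mem haw).1 hb).2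
    have h2 := h.idxOf_edge_lt ((hfin.mem_toFinset.mp hb').1)
    omega

/-- The exponents of successively visited nodes. -/
theorem Run.isChain {n : ℕ} {R : Fin (n + 1) → Finset (Fin (n + 1))} {s : NFSState n}
    (h : Run R s) :
    s.visited.IsChain (fun u v => (R v).card ≤ (R u).card ∨
      ((R v).card = (R u).card + 1 ∧ v < u)) ∧
    ∀ u ∈ s.visited.getLast?, s.pending.length ≤ (R u).card + 1 := by
  induction h with
  | init root => simp [nfsInit]
  | step hr h ih =>
    have hl := hr.lists
    cases h with
    | @mk vis rest c edg a₀ sorted notMem below =>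
      simp only [List.nodup_cons, List.mem_cons, List.length_cons] at hl ih ⊢
      have hcard := card_below_getElem hl.2.1.2 sorted
        (fun w hw hw' => notMem w hw (hl.2.2 w (.inr hw'))) below
      -- Between consecutive siblings the exponent rises by one and the label falls. Across the
      -- junction it cannot rise: since the last visit the stack has only shrunk, which is the
      -- second half of the invariant.
      refine ⟨List.isChain_append.mpr ⟨ih.1, ?_, ?_⟩, ?_⟩
      · rw [List.isChain_iff_getElem]
        intro i hi
        refine .inr ⟨?_, List.pairwise_iff_getElem.mp sorted _ _ _ _ (Nat.lt_succ_self i)⟩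
        rw [hcard, hcard, add_assoc]
      · intro u hu v hv
        left
        have h1 := ih.2 u hu
        rw [List.head?_eq_getElem?, Option.mem_def, List.getElem?_eq_some_iff] at hv
        obtain ⟨h0, rfl⟩ := hv
        rw [hcard]
        omega
      · intro u hu
        rw [List.length_append, List.length_reverse]
        rcases Nat.eq_zero_or_pos c.length with h0 | h0
        · rw [List.length_eq_zero_iff.mp h0, List.append_nil] at hu
          have := ih.2 u hu
          omega
        · rw [List.getLast?_append_of_ne_nil _ (List.ne_nil_of_length_pos h0),
            List.getLast?_eq_getElem?, Option.mem_def, List.getElem?_eq_some_iff] at hu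
          obtain ⟨h1, rfl⟩ := hu
          rw [hcard]
          omega

/-! ### Uniqueness and extension of searches -/

theorem Step.card_new {n : ℕ} {R : Fin (n + 1) → Finset (Fin (n + 1))}
    {vis rest c : List (Fin (n + 1))} {edg : List (Fin (n + 1) × Fin (n + 1))} {a : Fin (n + 1)}
    (hr : Run R ⟨vis, a :: rest, edg⟩) (sorted : c.Pairwise (· > ·)) (notMem : ∀ w ∈ c, w ∉ vis)
    (below : ∀ w ∈ c, R w = rest.toFinset ∪ c.toFinset.filter (w < ·)) (i : ℕ)
    (hi : i < c.length) : (R (c.get ⟨i, hi⟩)).card = rest.length + i := by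
  have hl := hr.lists
  exact card_below_getElem (List.nodup_cons.mp hl.2.1).2 sorted
    (fun w hw hw' => notMem w hw (hl.2.2 w (List.mem_cons_of_mem _ hw'))) below i hi

/-- The active node leaves the stack before its children enter, so the next node to be visited has
fewer nodes below it than are pending now. -/
theorem Reach.exists_visited_eq {n : ℕ} {R : Fin (n + 1) → Finset (Fin (n + 1))}
    {s f : NFSState n} (h : Reach R s f) (hs : Run R s) :
    ∃ rem, f.visited = s.visited ++ rem ∧ ∀ w ∈ rem.head?, (R w).card < s.pending.length := by
  induction h using Relation.ReflTransGen.head_induction_on with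
  | refl => exact ⟨[], by simp⟩
  | head hstep _ ih =>
    obtain ⟨rem, h1, h2⟩ := ih (hs.step hstep)
    cases hstep with
    | @mk vis rest c edg a₀ sorted notMem below =>
      refine ⟨c ++ rem, by rw [h1, List.append_assoc], ?_⟩
      intro w hw
      rcases c with _ | ⟨u, c⟩
      · have := h2 w hw
        simp only [List.reverse_nil, List.nil_append, List.length_cons] at this ⊢
        omega
      · simp only [List.cons_append, List.head?_cons, Option.mem_some_iff] at hw
        have := Step.card_new hs sorted notMem below 0 (by simp)
        simp only [List.get_eq_getElem, List.getElem_cons_zero, hw] at this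
        simp [this]

/-- If `l₂` were longer, its entry at index `l₁.length` would be the head of `m₁`, whose value is
too small. Applied to exponents, this shows that two searches must end a list of children at the
same place. -/
theorem length_le_of_append_eq {α : Type*} {h : α → ℕ} {r : ℕ} {l₁ l₂ m₁ m₂ : List α}
    (heq : l₁ ++ m₁ = l₂ ++ m₂) (h₁ : ∀ w ∈ m₁.head?, h w < l₁.length + r)
    (h₂ : ∀ (i : ℕ) (hi : i < l₂.length), h (l₂.get ⟨i, hi⟩) = r + i) :
    l₂.length ≤ l₁.length := by
  by_contra hlt
  rw [not_le] at hlt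
  have h3 : (l₁ ++ m₁)[l₁.length]? = (l₂ ++ m₂)[l₁.length]? := by rw [heq]
  rw [List.getElem?_append_right le_rfl, Nat.sub_self, List.getElem?_append_left hlt,
    List.getElem?_eq_getElem hlt, ← List.head?_eq_getElem?] at h3
  have h4 := h₁ _ h3
  have h5 := h₂ _ hlt
  simp only [List.get_eq_getElem] at h5
  omega

theorem Reach.unique {n : ℕ} {R₁ R₂ : Fin (n + 1) → Finset (Fin (n + 1))} {s f₁ f₂ : NFSState n}
    (h₁ : Reach R₁ s f₁) (h₂ : Reach R₂ s f₂) (hs₁ : Run R₁ s) (hs₂ : Run R₂ s)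
    (hp₁ : f₁.pending = []) (hp₂ : f₂.pending = []) (hv : f₁.visited = f₂.visited)
    (hc : ∀ w, (R₁ w).card = (R₂ w).card) : f₁ = f₂ := by
  induction h₁ using Relation.ReflTransGen.head_induction_on with
  | refl =>
    rcases h₂.cases_head with h | ⟨s', hstep, _⟩
    · exact h
    · cases hstep with
      | mk => exact absurd hp₁ (List.cons_ne_nil _ _)
  | head hstep h₁ ih =>
    rcases h₂.cases_head with h | ⟨s', hstep', h₂'⟩
    · subst h
      cases hstep with
      | mk => exact absurd hp₂ (List.cons_ne_nil _ _)
    · have hr₁ := hs₁.step hstep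
      have hr₂ := hs₂.step hstep'
      obtain ⟨m₁, hm₁, hh₁⟩ := Reach.exists_visited_eq h₁ hr₁
      obtain ⟨m₂, hm₂, hh₂⟩ := Reach.exists_visited_eq h₂' hr₂
      cases hstep with
      | @mk vis rest c edg a₀ sorted notMem below =>
        cases hstep' with
        | @mk _ _ c' _ _ sorted' notMem' below' =>
          have heq : c ++ m₁ = c' ++ m₂ := by
            have := hm₁.symm.trans (hv.trans hm₂)
            rw [List.append_assoc, List.append_assoc] at this
            exact List.append_cancel_left this
          simp only [List.length_append, List.length_reverse] at hh₁ hh₂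
          have hle := length_le_of_append_eq (h := fun w => (R₁ w).card) heq hh₁
            (fun i hi => (hc _).trans (Step.card_new hs₂ sorted' notMem' below' i hi))
          have hge := length_le_of_append_eq (h := fun w => (R₂ w).card) heq.symm hh₂
            (fun i hi => (hc _).symm.trans (Step.card_new hs₁ sorted notMem below i hi))
          obtain ⟨rfl, rfl⟩ := List.append_inj heq (le_antisymm hge hle)
          exact ih h₂' hr₁ hr₂

theorem Run.unique {n : ℕ} {R₁ R₂ : Fin (n + 1) → Finset (Fin (n + 1))} {f₁ f₂ : NFSState n}
    (h₁ : Run R₁ f₁) (h₂ : Run R₂ f₂) (hp₁ : f₁.pending = []) (hp₂ : f₂.pending = [])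
    (hv : f₁.visited = f₂.visited) (hc : ∀ w, (R₁ w).card = (R₂ w).card) : f₁ = f₂ :=
  Reach.unique h₁.reach h₂.reach (.init h₁.root) (.init h₂.root) hp₁ hp₂ hv hc

theorem Run.congr {n : ℕ} {R R' : Fin (n + 1) → Finset (Fin (n + 1))} {s : NFSState n}
    (h : Run R s) (hR : ∀ v ∈ s.visited, R' v = R v) : Run R' s := by
  induction h with
  | init root => exact .init ((hR _ (by simp [nfsInit])).trans root)
  | step hr h ih =>
    cases h with
    | @mk vis rest c edg a₀ sorted notMem below =>
      simp only [List.mem_append] at hR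
      exact (ih fun v hv => hR v (.inl hv)).step
        (.mk sorted notMem fun w hw => (hR w (.inr hw)).trans (below w hw))

/-- The function `R` is fixed for a whole search, so a further step requires redefining it on `c`.
The nodes of `c` being unvisited, the earlier steps do not notice. -/
theorem Run.extend {n : ℕ} {R : Fin (n + 1) → Finset (Fin (n + 1))}
    {vis rest c : List (Fin (n + 1))} {edg : List (Fin (n + 1) × Fin (n + 1))} {a : Fin (n + 1)}
    (h : Run R ⟨vis, a :: rest, edg⟩) (sorted : c.Pairwise (· > ·)) (notMem : ∀ w ∈ c, w ∉ vis) :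
    ∃ R', Run R' ⟨vis ++ c, c.reverse ++ rest, edg ++ c.map fun w => (a, w)⟩ ∧
      (∀ v ∈ vis, R' v = R v) ∧
      ∀ w ∈ c, R' w = rest.toFinset ∪ c.toFinset.filter (w < ·) := by
  let R' : Fin (n + 1) → Finset (Fin (n + 1)) := fun w =>
    if w ∈ c then rest.toFinset ∪ c.toFinset.filter (w < ·) else R w
  have h1 : ∀ v ∈ vis, R' v = R v := fun v hv => if_neg fun hc => notMem v hc hv
  have h2 : ∀ w ∈ c, R' w = rest.toFinset ∪ c.toFinset.filter (w < ·) := fun w hw => if_pos hw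
  exact ⟨R', (h.congr h1).step (.mk sorted notMem h2), h1, h2⟩

/-- The nodes below a node are determined by the final state. -/
theorem Run.below_eq {n : ℕ} {R₁ R₂ : Fin (n + 1) → Finset (Fin (n + 1))} {f : NFSState n}
    (h₁ : Run R₁ f) (h₂ : Run R₂ f) : ∀ w ∈ f.visited, R₁ w = R₂ w := by
  suffices ∀ (k : ℕ) (w), w ∈ f.visited → f.visited.idxOf w = k → R₁ w = R₂ w from
    fun w hw => this _ w hw rfl
  intro k
  induction k using Nat.strong_induction_on with
  | _ k ih =>
    intro w hw hk
    by_cases hne : w = Fin.last n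
    · rw [hne, h₁.root, h₂.root]
    · obtain ⟨a, ha⟩ := h₁.exists_edge hw hne
      ext b
      rw [h₁.mem_below_iff ha, h₂.mem_below_iff ha,
        ih _ (hk ▸ h₁.idxOf_edge_lt ha) a (h₁.edge_mem ha).1 rfl]

/-! ### The neighbors-first search on a graph -/

theorem mem_newNeighbors {n : ℕ} {G : SimpleGraph (Fin (n + 1))} [DecidableRel G.Adj]
    {vis : List (Fin (n + 1))} {a w : Fin (n + 1)} :
    w ∈ newNeighbors G vis a ↔ G.Adj a w ∧ w ∉ vis := by
  simp [newNeighbors]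

theorem sorted_newNeighbors {n : ℕ} (G : SimpleGraph (Fin (n + 1))) [DecidableRel G.Adj]
    (vis : List (Fin (n + 1))) (a : Fin (n + 1)) :
    (newNeighbors G vis a).Pairwise (· > ·) :=
  (List.pairwise_reverse.mpr (List.pairwise_lt_finRange _)).filter _

theorem exists_run_iterate {n : ℕ} (G : SimpleGraph (Fin (n + 1))) [DecidableRel G.Adj] (t : ℕ) :
    ∃ R, Run R ((nfsStep G)^[t] (nfsInit n)) := by
  induction t with
  | zero => exact ⟨fun _ => ∅, .init rfl⟩
  | succ t ih =>
    obtain ⟨R, hR⟩ := ih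
    rw [Function.iterate_succ_apply']
    generalize (nfsStep G)^[t] (nfsInit n) = s at hR
    rcases s with ⟨vis, _ | ⟨a, rest⟩, edg⟩
    · exact ⟨R, hR⟩
    · obtain ⟨R', hR', -⟩ := hR.extend (sorted_newNeighbors G vis a)
        fun w hw => (mem_newNeighbors.mp hw).2
      exact ⟨R', hR'⟩

theorem exists_run_nfsRun {n : ℕ} (G : SimpleGraph (Fin (n + 1))) [DecidableRel G.Adj] :
    ∃ R, Run R (nfsRun G) :=
  exists_run_iterate G (n + 1)

theorem Run.length_visited_le {n : ℕ} {R : Fin (n + 1) → Finset (Fin (n + 1))} {s : NFSState n}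
    (h : Run R s) : s.visited.length ≤ n + 1 := by
  simpa using h.lists.1.length_le_card

/-- While the stack is nonempty, each step removes one node from it, and new nodes count both as
visited and as pending. So visited minus pending counts the steps, and at most `n + 1` nodes can be
visited. -/
theorem nfsRun_pending {n : ℕ} (G : SimpleGraph (Fin (n + 1))) [DecidableRel G.Adj] :
    (nfsRun G).pending = [] := by
  have key : ∀ t, ((nfsStep G)^[t] (nfsInit n)).pending = [] ∨
      ((nfsStep G)^[t] (nfsInit n)).visited.length =
        ((nfsStep G)^[t] (nfsInit n)).pending.length + t := by
    intro t
    induction t with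
    | zero => exact .inr rfl
    | succ t ih =>
      rw [Function.iterate_succ_apply']
      generalize (nfsStep G)^[t] (nfsInit n) = s at ih
      rcases s with ⟨vis, _ | ⟨a, rest⟩, edg⟩
      · exact .inl rfl
      · right
        have := ih.resolve_left (List.cons_ne_nil _ _)
        simp only [nfsStep, List.length_cons, List.length_append, List.length_reverse] at this ⊢
        omega
  obtain ⟨R, hR⟩ := exists_run_nfsRun G
  rcases key (n + 1) with h | h
  · exact h
  · have h1 : (nfsRun G).visited.length = (nfsRun G).pending.length + (n + 1) := h
    have := hR.length_visited_le
    exact List.length_eq_zero_iff.mp (by omega)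

theorem nfsStep_induction {n : ℕ} (G : SimpleGraph (Fin (n + 1))) [DecidableRel G.Adj]
    {P : NFSState n → Prop} (h0 : P (nfsInit n)) (h : ∀ R s, Run R s → P s → P (nfsStep G s)) :
    P (nfsRun G) := by
  suffices ∀ t, P ((nfsStep G)^[t] (nfsInit n)) from this _
  intro t
  induction t with
  | zero => exact h0
  | succ t ih =>
    obtain ⟨R, hR⟩ := exists_run_iterate G t
    rw [Function.iterate_succ_apply']
    exact h R _ hR ih

theorem nfsRun_closed {n : ℕ} (G : SimpleGraph (Fin (n + 1))) [DecidableRel G.Adj]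
    {a w : Fin (n + 1)} (ha : a ∈ (nfsRun G).visited) (haw : G.Adj a w) :
    w ∈ (nfsRun G).visited := by
  have key := nfsStep_induction G
    (P := fun s => ∀ a ∈ s.visited, a ∉ s.pending → ∀ w, G.Adj a w → w ∈ s.visited)
    (by simp [nfsInit]) (by
      rintro R ⟨vis, _ | ⟨b, rest⟩, edg⟩ hR hP
      · exact hP
      · intro a ha hap w haw
        simp only [nfsStep, List.mem_append, List.mem_reverse, not_or, mem_newNeighbors] at *
        have hav := ha.resolve_right hap.1
        by_cases hw : w ∈ vis
        · exact .inl hw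
        · by_cases hab : a = b
          · exact .inr ⟨hab ▸ haw, hw⟩
          · exact .inl (hP a hav (by simp [hab, hap.2]) w haw))
  exact key a ha (by simp [nfsRun_pending]) w haw

theorem adj_of_mem_nfsRun_edges {n : ℕ} (G : SimpleGraph (Fin (n + 1))) [DecidableRel G.Adj]
    {a w : Fin (n + 1)} (h : (a, w) ∈ (nfsRun G).edges) : G.Adj a w := by
  refine nfsStep_induction G (P := fun s => ∀ a w, (a, w) ∈ s.edges → G.Adj a w)
    (by simp [nfsInit]) ?_ a w h
  rintro R ⟨vis, _ | ⟨b, rest⟩, edg⟩ hR hP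
  · exact hP
  · intro a w haw
    simp only [nfsStep, List.mem_append, List.mem_map, mem_newNeighbors, Prod.mk.injEq] at haw
    rcases haw with haw | ⟨u, hu, rfl, rfl⟩
    · exact hP a w haw
    · exact hu.1

theorem mem_visited_nfsRun {n : ℕ} {G : SimpleGraph (Fin (n + 1))} [DecidableRel G.Adj]
    (hG : G.Connected) (v : Fin (n + 1)) : v ∈ (nfsRun G).visited := by
  obtain ⟨R, hR⟩ := exists_run_nfsRun G
  obtain ⟨t, ht⟩ := hR.exists_visited_eq_cons
  have key : ∀ u v, G.Walk u v → u ∈ (nfsRun G).visited → v ∈ (nfsRun G).visited := by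
    intro u v p
    induction p with
    | nil => exact id
    | cons h _ ih => exact fun hu => ih (nfsRun_closed G hu h)
  obtain ⟨p⟩ := hG.preconnected (Fin.last n) v
  exact key _ _ p (by simp [ht])

/-! ### Graphs with a given search tree -/

theorem Reach.exists_edges_eq {n : ℕ} {R : Fin (n + 1) → Finset (Fin (n + 1))}
    {s f : NFSState n} (h : Reach R s f) (hs : Run R s) :
    ∃ E, f.edges = s.edges ++ E ∧
      ∀ u w, (u, w) ∈ E → w ∉ s.visited ∧ (u ∈ s.visited → u ∈ s.pending) := by
  induction h using Relation.ReflTransGen.head_induction_on with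
  | refl => exact ⟨[], by simp⟩
  | head hstep _ ih =>
    obtain ⟨E, h1, h2⟩ := ih (hs.step hstep)
    cases hstep with
    | @mk vis rest c edg a₀ sorted notMem below =>
      refine ⟨c.map (fun w => (a₀, w)) ++ E, by rw [h1, List.append_assoc], fun u w huw => ?_⟩
      simp only [List.mem_append, List.mem_map, Prod.mk.injEq, not_or, List.mem_reverse] at huw h2
      rcases huw with ⟨x, hx, rfl, rfl⟩ | huw
      · exact ⟨notMem _ hx, fun _ => List.mem_cons_self⟩
      · obtain ⟨h3, h4⟩ := h2 u w huw
        refine ⟨h3.1, fun hu => List.mem_cons_of_mem _ ?_⟩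
        exact (h4 (.inl hu)).resolve_left fun hc => notMem u hc hu

/-- A node that has left the stack never returns to it, so it cannot lie below a node visited later.
-/
theorem Reach.mem_pending_of_below {n : ℕ} {R : Fin (n + 1) → Finset (Fin (n + 1))}
    {s f : NFSState n} (h : Reach R s f) {w b : Fin (n + 1)} (hw : w ∈ f.visited)
    (hws : w ∉ s.visited) (hb : b ∈ R w) (hbs : b ∈ s.visited) : b ∈ s.pending := by
  induction h using Relation.ReflTransGen.head_induction_on with
  | refl => exact absurd hw hws
  | head hstep _ ih =>
    cases hstep with
    | @mk vis rest c edg a₀ sorted notMem below =>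
      simp only [List.mem_append, List.mem_reverse, not_or] at ih
      refine List.mem_cons_of_mem _ ?_
      by_cases hwc : w ∈ c
      · rw [below w hwc, Finset.mem_union, Finset.mem_filter, List.mem_toFinset,
          List.mem_toFinset] at hb
        exact hb.resolve_right fun h => notMem b h.1 hbs
      · exact (ih ⟨hws, hwc⟩ (.inl hbs)).resolve_left fun h => notMem b h hbs

theorem eq_of_sorted_of_mem_iff {m : ℕ} {l₁ l₂ : List (Fin m)} (h₁ : l₁.Pairwise (· > ·))
    (h₂ : l₂.Pairwise (· > ·)) (h : ∀ a, a ∈ l₁ ↔ a ∈ l₂) : l₁ = l₂ :=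
  ((List.perm_ext_iff_of_nodup (nodup_of_sorted h₁) (nodup_of_sorted h₂)).mpr h).eq_of_pairwise
    (fun _ _ _ _ h h' => absurd h (lt_asymm h')) h₁ h₂

/-- A search that has visited all nodes, each of which has been active. -/
structure CompleteRun {n : ℕ} (R : Fin (n + 1) → Finset (Fin (n + 1))) (f : NFSState n) :
    Prop where
  run : Run R f
  pending : f.pending = []
  mem_visited : ∀ v, v ∈ f.visited

theorem exists_completeRun {n : ℕ} {G : SimpleGraph (Fin (n + 1))} [DecidableRel G.Adj]
    (hG : G.Connected) : ∃ R, CompleteRun R (nfsRun G) := by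
  obtain ⟨R, hR⟩ := exists_run_nfsRun G
  exact ⟨R, hR, nfsRun_pending G, mem_visited_nfsRun hG⟩

theorem CompleteRun.length_visited {n : ℕ} {R : Fin (n + 1) → Finset (Fin (n + 1))}
    {f : NFSState n} (h : CompleteRun R f) : f.visited.length = n + 1 := by
  have h1 : f.visited.toFinset = Finset.univ := by
    ext v
    simp [h.mem_visited v]
  rw [← List.toFinset_card_of_nodup h.run.lists.1, h1, Finset.card_univ, Fintype.card_fin]

/-- An extra edge between a node and one pending below it has no effect: when the upper node is
active the lower one is already visited, and the lower one becomes active only after the upper one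
has been visited. -/
theorem CompleteRun.nfsRun_eq {n : ℕ} {R : Fin (n + 1) → Finset (Fin (n + 1))}
    {f : NFSState n} (h : CompleteRun R f) (G : SimpleGraph (Fin (n + 1))) [DecidableRel G.Adj]
    (h1 : ∀ a w, (a, w) ∈ f.edges → G.Adj a w)
    (h2 : ∀ a w, G.Adj a w → (a, w) ∈ f.edges ∨ (w, a) ∈ f.edges ∨ w ∈ R a ∨ a ∈ R w) :
    nfsRun G = f := by
  have hstep : ∀ s s', Run R s → Step R s s' → Reach R s' f → s' = nfsStep G s := by
    intro s s' hs hss hf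
    obtain ⟨E, hE, hE'⟩ := Reach.exists_edges_eq hf (hs.step hss)
    have hbelow := fun w b => Reach.mem_pending_of_below (w := w) (b := b)
      (Relation.ReflTransGen.head hss hf) (h.mem_visited w)
    have hl := hs.lists
    have hst := hs.isStack
    have hem := fun {u v} => hs.edge_mem (a := u) (w := v)
    cases hss with
    | @mk vis rest c edg a₀ sorted notMem below =>
      simp only [List.nodup_cons, List.mem_cons, List.mem_append, List.mem_reverse, not_or]
        at hl hem hE' hE hbelow
      have ha₀ := hl.2.2 a₀ (.inl rfl)
      suffices c = newNeighbors G vis a₀ by subst this; rfl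
      refine eq_of_sorted_of_mem_iff sorted (sorted_newNeighbors G vis a₀) fun w => ?_
      rw [mem_newNeighbors]
      constructor
      · intro hw
        exact ⟨h1 _ _ (by simp [hE, hw]), notMem w hw⟩
      · rintro ⟨hadj, hw⟩
        rcases h2 _ _ hadj with he | he | he | he
        · rw [hE, List.mem_append, List.mem_append] at he
          rcases he with (he | he) | he
          · exact absurd (hem he).2.2 hw
          · simpa using he
          · rcases (hE' _ _ he).2 (.inl ha₀) with hc | hc
            · exact absurd ha₀ (notMem _ hc)
            · exact absurd hc hl.2.1.1
        · rw [hE, List.mem_append, List.mem_append] at he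
          rcases he with (he | he) | he
          · exact absurd (hem he).1 hw
          · obtain ⟨u, hu, huw⟩ := List.mem_map.mp he
            rw [Prod.mk.injEq] at huw
            exact absurd (huw.1 ▸ ha₀) hw
          · exact absurd ha₀ (hE' _ _ he).1.1
        · rw [hst.1, List.mem_toFinset] at he
          exact absurd (hl.2.2 w (.inr he)) hw
        · have hs' := Reach.mem_pending_of_below hf (h.mem_visited w) (b := a₀)
          by_contra hwc
          simp only [List.mem_append, List.mem_reverse, not_or] at hs'
          rcases hs' ⟨hw, hwc⟩ he (.inl ha₀) with hc | hc
          · exact notMem _ hc ha₀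
          · exact hl.2.1.1 hc
  -- Counting the steps along with the states shows that the complete search takes exactly the `n +
  -- 1` steps performed by `nfsRun`.
  have key : ∀ s, Run R s → Reach R s f →
      ∃ k, s = (nfsStep G)^[k] (nfsInit n) ∧ s.visited.length = s.pending.length + k := by
    intro s hs
    induction hs with
    | init root => exact fun _ => ⟨0, rfl, rfl⟩
    | step hs hss ih =>
      intro hf
      obtain ⟨k, hk, hlen⟩ := ih (hf.head hss)
      refine ⟨k + 1, ?_, ?_⟩
      · rw [Function.iterate_succ_apply', ← hk]
        exact hstep _ _ hs hss hf
      · cases hss with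
        | mk =>
          simp only [List.length_cons, List.length_append, List.length_reverse] at hlen ⊢
          omega
  obtain ⟨k, hk, hlen⟩ := key f h.run .refl
  rw [h.length_visited, h.pending, List.length_nil, Nat.zero_add] at hlen
  rw [hk, ← hlen]
  rfl

/-- The search tree of a search. -/
def NFSState.tree {n : ℕ} (f : NFSState n) : SimpleGraph (Fin (n + 1)) :=
  SimpleGraph.fromRel fun u v => (u, v) ∈ f.edges

theorem Run.ne_of_edge {n : ℕ} {R : Fin (n + 1) → Finset (Fin (n + 1))} {s : NFSState n}
    (h : Run R s) {a w : Fin (n + 1)} (haw : (a, w) ∈ s.edges) : a ≠ w := fun heq =>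
  (h.idxOf_edge_lt haw).ne (by rw [heq])

theorem Run.tree_adj {n : ℕ} {R : Fin (n + 1) → Finset (Fin (n + 1))} {s : NFSState n}
    (h : Run R s) {a w : Fin (n + 1)} :
    s.tree.Adj a w ↔ (a, w) ∈ s.edges ∨ (w, a) ∈ s.edges := by
  rw [NFSState.tree, SimpleGraph.fromRel_adj]
  exact and_iff_right_of_imp fun h' =>
    h'.elim (fun h' => h.ne_of_edge h') fun h' => (h.ne_of_edge h').symm

theorem Run.reachable {n : ℕ} {R : Fin (n + 1) → Finset (Fin (n + 1))} {s : NFSState n}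
    (h : Run R s) : ∀ w ∈ s.visited, s.tree.Reachable (Fin.last n) w := by
  suffices ∀ (k : ℕ) (w), w ∈ s.visited → s.visited.idxOf w = k →
    s.tree.Reachable (Fin.last n) w from fun w hw => this _ w hw rfl
  intro k
  induction k using Nat.strong_induction_on with
  | _ k ih =>
    intro w hw hk
    by_cases hne : w = Fin.last n
    · rw [hne]
    · obtain ⟨a, ha⟩ := h.exists_edge hw hne
      exact (ih _ (hk ▸ h.idxOf_edge_lt ha) a (h.edge_mem ha).1 rfl).trans
        (h.tree_adj.mpr (.inl ha)).reachable

theorem CompleteRun.isTree {n : ℕ} {R : Fin (n + 1) → Finset (Fin (n + 1))}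
    {f : NFSState n} (h : CompleteRun R f) : f.tree.IsTree := by
  have hconn : f.tree.Connected := by
    rw [SimpleGraph.connected_iff_exists_forall_reachable]
    exact ⟨Fin.last n, fun w => h.run.reachable w (h.mem_visited w)⟩
  refine SimpleGraph.isTree_iff_connected_and_card.mpr ⟨hconn, ?_⟩
  refine le_antisymm ?_ hconn.card_vert_le_card_edgeSet_add_one
  have hsub : f.tree.edgeSet ⊆ ↑(f.edges.toFinset.image fun e => s(e.1, e.2)) := by
    intro e
    induction e using Sym2.ind with
    | _ a w =>
      rw [SimpleGraph.mem_edgeSet, h.run.tree_adj, Finset.mem_coe, Finset.mem_image]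
      rintro (h | h)
      · exact ⟨(a, w), List.mem_toFinset.mpr h, rfl⟩
      · exact ⟨(w, a), List.mem_toFinset.mpr h, Sym2.eq_swap⟩
  have h1 : Nat.card f.tree.edgeSet ≤ f.edges.length := by
    rw [Nat.card_coe_set_eq]
    refine (Set.ncard_le_ncard hsub (Finset.finite_toSet _)).trans ?_
    rw [Set.ncard_coe_finset]
    exact Finset.card_image_le.trans (List.toFinset_card_le _)
  have h2 := h.length_visited
  have h3 := h.run.length_edges
  rw [Nat.card_fin]
  omega

theorem CompleteRun.nfsRun_tree {n : ℕ} {R : Fin (n + 1) → Finset (Fin (n + 1))}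
    {f : NFSState n} (h : CompleteRun R f) [DecidableRel f.tree.Adj] : nfsRun f.tree = f := by
  refine h.nfsRun_eq _ (fun a w haw => h.run.tree_adj.mpr (.inl haw)) fun a w haw => ?_
  exact (h.run.tree_adj.mp haw).imp_right .inl

open Classical in
theorem nfsTree_eq_tree {n : ℕ} (G : SimpleGraph (Fin (n + 1))) : nfsTree G = (nfsRun G).tree :=
  rfl

theorem nfsTree_le {n : ℕ} (G : SimpleGraph (Fin (n + 1))) : nfsTree G ≤ G := by
  classical
  intro a w haw
  obtain ⟨R, hR⟩ := exists_run_nfsRun G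
  rw [nfsTree_eq_tree, hR.tree_adj] at haw
  exact haw.elim (fun h => adj_of_mem_nfsRun_edges G h)
    fun h => (adj_of_mem_nfsRun_edges G h).symm

theorem isTree_nfsTree {n : ℕ} {G : SimpleGraph (Fin (n + 1))} (hG : G.Connected) :
    (nfsTree G).IsTree := by
  classical
  obtain ⟨R, hR⟩ := exists_completeRun hG
  exact hR.isTree

/-- A tree is a minimal connected graph, and its search tree is a connected subgraph of it. -/
theorem nfsTree_eq_self {n : ℕ} {T : SimpleGraph (Fin (n + 1))} (hT : T.IsTree) :
    nfsTree T = T :=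
  (SimpleGraph.isTree_iff_minimal_connected.mp hT).eq_of_le
    (isTree_nfsTree hT.connected).connected (nfsTree_le T)

/-- The state of a search is determined by its search tree. -/
theorem nfsRun_eq_of_nfsTree_eq {n : ℕ} {G T : SimpleGraph (Fin (n + 1))} [DecidableRel G.Adj]
    [DecidableRel T.Adj] (hG : G.Connected) (h : nfsTree G = T) : nfsRun T = nfsRun G := by
  classical
  obtain ⟨R, hR⟩ := exists_completeRun hG
  have h' : T = (nfsRun G).tree := by
    rw [← h, nfsTree_eq_tree]
    congr!
  subst h'
  exact hR.nfsRun_tree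

/-! ### Exponents -/

theorem Run.exists_depth {n : ℕ} {R : Fin (n + 1) → Finset (Fin (n + 1))} {s : NFSState n}
    (h : Run R s) : ∃ d : Fin (n + 1) → ℕ, d (Fin.last n) = 0 ∧
      ∀ a w, (a, w) ∈ s.edges → d w = d a + 1 := by
  induction h with
  | init root => exact ⟨fun _ => 0, rfl, by simp [nfsInit]⟩
  | step hr h ih =>
    obtain ⟨d, hd0, hd⟩ := ih
    have hl := hr.lists
    have hem := fun {u v} => hr.edge_mem (a := u) (w := v)
    obtain ⟨t, ht⟩ := hr.exists_visited_eq_cons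
    cases h with
    | @mk vis rest c edg a₀ sorted notMem below =>
      simp only at hl hem ht hd
      have hnc : ∀ v ∈ vis, v ∉ c := fun v hv hc => notMem v hc hv
      refine ⟨fun v => if v ∈ c then d a₀ + 1 else d v, ?_, fun a w haw => ?_⟩
      · simp only [if_neg (hnc _ (ht ▸ List.mem_cons_self)), hd0]
      · simp only [List.mem_append, List.mem_map, Prod.mk.injEq] at haw
        rcases haw with haw | ⟨u, hu, rfl, rfl⟩
        · simp only [if_neg (hnc _ (hem haw).1), if_neg (hnc _ (hem haw).2.2), hd a w haw]
        · simp only [if_pos hu, if_neg (hnc _ (hl.2.2 _ List.mem_cons_self))]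

theorem Run.edge_unique {n : ℕ} {R : Fin (n + 1) → Finset (Fin (n + 1))} {s : NFSState n}
    (h : Run R s) {a b w : Fin (n + 1)} (ha : (a, w) ∈ s.edges) (hb : (b, w) ∈ s.edges) :
    a = b := by
  induction h with
  | init root => simp [nfsInit] at ha
  | step hr h ih =>
    have hem := fun {u v} => hr.edge_mem (a := u) (w := v)
    cases h with
    | @mk vis rest c edg a₀ sorted notMem below =>
      simp only [List.mem_append, List.mem_map, Prod.mk.injEq] at ha hb hem ih
      rcases ha with ha | ⟨u, hu, rfl, rfl⟩ <;> rcases hb with hb | ⟨v, hv, rfl, hvu⟩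
      · exact ih ha hb
      · exact absurd (hem ha).2.2 (notMem _ (hvu ▸ hv))
      · exact absurd (hem hb).2.2 (notMem _ hu)
      · rfl

/-- The depth in the search equals the distance from the root. It changes by one along each edge, so
it is at most the length of any walk from the root; the chain of parents attains it. -/
theorem CompleteRun.dist_edge {n : ℕ} {R : Fin (n + 1) → Finset (Fin (n + 1))}
    {f : NFSState n} (h : CompleteRun R f) {a w : Fin (n + 1)} (haw : (a, w) ∈ f.edges) :
    f.tree.dist (Fin.last n) w = f.tree.dist (Fin.last n) a + 1 := by
  obtain ⟨d, hd0, hd⟩ := h.run.exists_depth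
  have hconn := h.isTree.connected
  have hwalk : ∀ u v (p : f.tree.Walk u v), d v ≤ d u + p.length := by
    intro u v p
    induction p with
    | nil => simp
    | cons hadj _ ih =>
      rw [SimpleGraph.Walk.length_cons]
      rcases h.run.tree_adj.mp hadj with h' | h' <;> have := hd _ _ h' <;> omega
  have hge : ∀ v, d v ≤ f.tree.dist (Fin.last n) v := by
    intro v
    obtain ⟨p, hp⟩ := hconn.exists_walk_length_eq_dist (Fin.last n) v
    have := hwalk _ _ p
    omega
  have hle : ∀ (k : ℕ) (v), f.visited.idxOf v = k → f.tree.dist (Fin.last n) v ≤ d v := by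
    intro k
    induction k using Nat.strong_induction_on with
    | _ k ih =>
      intro v hk
      by_cases hne : v = Fin.last n
      · simp [hne]
      · obtain ⟨b, hb⟩ := h.run.exists_edge (h.mem_visited v) hne
        have h1 := ih _ (hk ▸ h.run.idxOf_edge_lt hb) b rfl
        have h2 := hconn.dist_triangle (u := Fin.last n) (v := b) (w := v)
        rw [SimpleGraph.dist_eq_one_iff_adj.mpr (h.run.tree_adj.mpr (.inl hb))] at h2
        have := hd _ _ hb
        omega
  have heq : ∀ v, f.tree.dist (Fin.last n) v = d v := fun v => le_antisymm (hle _ v rfl) (hge v)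
  rw [heq, heq, hd _ _ haw]

theorem CompleteRun.isSucc_iff {n : ℕ} {R : Fin (n + 1) → Finset (Fin (n + 1))}
    {f : NFSState n} (h : CompleteRun R f) {a w : Fin (n + 1)} :
    IsSucc f.tree a w ↔ (a, w) ∈ f.edges := by
  rw [IsSucc, h.run.tree_adj]
  constructor
  · rintro ⟨haw | haw, hd⟩
    · exact haw
    · have := h.dist_edge haw
      omega
  · exact fun haw => ⟨.inl haw, h.dist_edge haw⟩

theorem CompleteRun.parent_eq {n : ℕ} {R : Fin (n + 1) → Finset (Fin (n + 1))}
    {f : NFSState n} (h : CompleteRun R f) {a w : Fin (n + 1)} (haw : (a, w) ∈ f.edges) :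
    parent f.tree w = a := by
  have hex : ∃ v, IsSucc f.tree v w := ⟨a, h.isSucc_iff.mpr haw⟩
  rw [parent, dif_pos hex]
  exact h.run.edge_unique (h.isSucc_iff.mp hex.choose_spec) haw

theorem CompleteRun.exponent_tree {n : ℕ} {R : Fin (n + 1) → Finset (Fin (n + 1))}
    {f : NFSState n} (h : CompleteRun R f) (w : Fin (n + 1)) :
    exponent f.tree w = (R w).card := by
  suffices ∀ k w, f.tree.dist (Fin.last n) w = k → exponentAux f.tree k w = (R w).card from
    this _ w rfl
  intro k
  induction k with
  | zero =>
    intro w hw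
    rw [← h.isTree.connected.dist_eq_zero_iff.mp hw, h.run.root]
    rfl
  | succ k ih =>
    intro w hw
    have hne : w ≠ Fin.last n := by
      rintro rfl
      simp at hw
    obtain ⟨a, ha⟩ := h.run.exists_edge (h.mem_visited w) hne
    have hd := h.dist_edge ha
    rw [exponentAux, h.parent_eq ha, ih a (by omega), h.run.card_below ha]
    simp only [h.isSucc_iff]

/-- The data of the neighbors-first search on a labeled tree. -/
theorem exists_completeRun_of_isTree {n : ℕ} {T : SimpleGraph (Fin (n + 1))}
    [DecidableRel T.Adj] (hT : T.IsTree) :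
    ∃ R, CompleteRun R (nfsRun T) ∧ (nfsRun T).tree = T ∧
      ∀ v, exponent T v = (R v).card := by
  obtain ⟨R, hR⟩ := exists_completeRun hT.connected
  have htree : (nfsRun T).tree = T := by
    refine Eq.trans ?_ (nfsTree_eq_self hT)
    rw [nfsTree_eq_tree]
    congr!
  refine ⟨R, hR, htree, fun v => ?_⟩
  rw [← hR.exponent_tree v, htree]

/-! ### The number of graphs with a given search tree -/

theorem CompleteRun.below_asymm {n : ℕ} {R : Fin (n + 1) → Finset (Fin (n + 1))}
    {f : NFSState n} (h : CompleteRun R f) {a w : Fin (n + 1)} (haw : w ∈ R a) : a ∉ R w :=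
  fun hwa => lt_asymm (h.run.mem_below (h.mem_visited a) haw).2
    (h.run.mem_below (h.mem_visited w) hwa).2

theorem CompleteRun.not_tree_adj_of_below {n : ℕ} {R : Fin (n + 1) → Finset (Fin (n + 1))}
    {f : NFSState n} (h : CompleteRun R f) {a w : Fin (n + 1)} (haw : w ∈ R a) :
    ¬ f.tree.Adj a w := by
  rw [h.run.tree_adj]
  rintro (he | he)
  · exact lt_asymm (h.run.mem_below (h.mem_visited a) haw).2 (h.run.idxOf_edge_lt he)
  · rcases (h.run.mem_below_iff he w).mp haw with hw | ⟨hw, -⟩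
    · exact h.below_asymm hw hw
    · exact h.run.ne_of_edge hw rfl

/-- An edge of a graph is an edge of its search tree, or one end is pending below the other. -/
theorem edge_or_below {n : ℕ} {G : SimpleGraph (Fin (n + 1))} [DecidableRel G.Adj]
    {R : Fin (n + 1) → Finset (Fin (n + 1))} (h : CompleteRun R (nfsRun G))
    {a w : Fin (n + 1)} (haw : G.Adj a w) :
    (a, w) ∈ (nfsRun G).edges ∨ (w, a) ∈ (nfsRun G).edges ∨ w ∈ R a ∨ a ∈ R w := by
  obtain ⟨R', hR', key⟩ := nfsStep_induction G
    (P := fun s => ∃ R', Run R' s ∧ ∀ a ∈ s.visited, a ∉ s.pending → ∀ w, G.Adj a w →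
      w ∈ s.visited ∧ ((a, w) ∈ s.edges ∨ (w, a) ∈ s.edges ∨ w ∈ R' a ∨ a ∈ R' w))
    ⟨fun _ => ∅, .init rfl, by simp [nfsInit]⟩ (by
      rintro - ⟨vis, _ | ⟨b, rest⟩, edg⟩ - ⟨R', hR', hP⟩
      · exact ⟨R', hR', hP⟩
      · obtain ⟨R'', hR'', hvis, -⟩ := hR'.extend (sorted_newNeighbors G vis b)
          fun w hw => (mem_newNeighbors.mp hw).2
        refine ⟨R'', hR'', fun a ha hap w haw => ?_⟩
        have hst := hR'.isStack.1
        have hb : b ∈ vis := hR'.lists.2.2 b List.mem_cons_self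
        simp only [nfsStep, List.mem_append, List.mem_reverse, not_or, mem_newNeighbors,
          List.mem_cons, List.mem_map, Prod.mk.injEq] at ha hap hP ⊢
        have hav := ha.resolve_right hap.1
        -- A neighbor of the node that has just become active is unvisited and becomes a child, or
        -- is pending below it, or was active earlier; in the last case the invariant applies with
        -- the two ends exchanged.
        by_cases hab : a = b
        · subst hab
          by_cases hw : w ∈ vis
          · refine ⟨.inl hw, ?_⟩
            rw [hvis a hav, hvis w hw]
            by_cases hwr : w ∈ rest
            · exact .inr (.inr (.inl (hst ▸ List.mem_toFinset.mpr hwr)))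
            · have := (hP w hw ⟨haw.ne', hwr⟩ a haw.symm).2
              tauto
          · exact ⟨.inr ⟨haw, hw⟩, .inl (.inr ⟨w, ⟨haw, hw⟩, rfl, rfl⟩)⟩
        · obtain ⟨hw, h'⟩ := hP a hav ⟨hab, hap.2⟩ w haw
          refine ⟨.inl hw, ?_⟩
          rw [hvis a hav, hvis w hw]
          tauto)
  rw [h.run.below_eq hR' a (h.mem_visited a), h.run.below_eq hR' w (h.mem_visited w)]
  exact (key a (h.mem_visited a) (by simp [h.pending]) w haw).2

theorem ncard_nfsTree_fiber {n : ℕ} {T : SimpleGraph (Fin (n + 1))} (hT : T.IsTree) :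
    {G : SimpleGraph (Fin (n + 1)) | G.Connected ∧ nfsTree G = T}.ncard = 2 ^ alpha T := by
  classical
  obtain ⟨R, hR, htree, hexp⟩ := exists_completeRun_of_isTree hT
  have hadj : ∀ {a w}, T.Adj a w ↔ (a, w) ∈ (nfsRun T).edges ∨ (w, a) ∈ (nfsRun T).edges :=
    fun {a w} => by rw [← hR.run.tree_adj, htree]
  have hnot : ∀ {a w}, w ∈ R a → ¬ T.Adj a w := fun h => htree ▸ hR.not_tree_adj_of_below h
  -- The optional edges, each recorded as a node together with a node below it.
  let K : Finset (Σ _ : Fin (n + 1), Fin (n + 1)) := Finset.univ.sigma R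
  have hK : ∀ {a w}, (⟨a, w⟩ : Σ _ : Fin (n + 1), Fin (n + 1)) ∈ K ↔ w ∈ R a := by simp [K]
  have hKcard : K.card = alpha T := by
    rw [Finset.card_sigma, Fin.sum_univ_castSucc, hR.run.root, Finset.card_empty, add_zero, alpha]
    exact Finset.sum_congr rfl fun k _ => (hexp _).symm
  let F : Finset (Σ _ : Fin (n + 1), Fin (n + 1)) → SimpleGraph (Fin (n + 1)) := fun E =>
    T ⊔ SimpleGraph.fromRel fun a w => ⟨a, w⟩ ∈ E
  have hF : ∀ {E a w}, (F E).Adj a w ↔ T.Adj a w ∨ (a ≠ w ∧ (⟨a, w⟩ ∈ E ∨ ⟨w, a⟩ ∈ E)) := by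
    intro E a w
    rw [SimpleGraph.sup_adj, SimpleGraph.fromRel_adj]
  have himage : {G : SimpleGraph (Fin (n + 1)) | G.Connected ∧ nfsTree G = T} =
      ↑(K.powerset.image F) := by
    ext G
    simp only [Set.mem_ofPred_eq, Finset.coe_image, Set.mem_image, Finset.mem_coe,
      Finset.mem_powerset]
    constructor
    · rintro ⟨hG, hGT⟩
      have hrun := nfsRun_eq_of_nfsTree_eq hG hGT
      refine ⟨K.filter fun e => G.Adj e.1 e.2, Finset.filter_subset _ _, ?_⟩
      ext a w
      rw [hF, Finset.mem_filter, Finset.mem_filter, hK, hK]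
      constructor
      · rintro (h | ⟨-, h | h⟩)
        · exact nfsTree_le G (hGT ▸ h)
        · exact h.2
        · exact h.2.symm
      · intro h
        have := edge_or_below (hrun ▸ hR) h
        rw [← hrun, ← or_assoc, ← hadj] at this
        rcases this with h' | h' | h'
        · exact .inl h'
        · exact .inr ⟨h.ne, .inl ⟨h', h⟩⟩
        · exact .inr ⟨h.ne, .inr ⟨h', h.symm⟩⟩
    · rintro ⟨E, hE, rfl⟩
      refine ⟨hT.connected.mono le_sup_left, ?_⟩
      rw [nfsTree_eq_tree, hR.nfsRun_eq, htree]
      · exact fun a w h => hF.mpr (.inl (hadj.mpr (.inl h)))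
      · intro a w h
        rcases hF.mp h with h | ⟨-, h | h⟩
        · exact (hadj.mp h).imp_right .inl
        · exact .inr (.inr (.inl (hK.mp (hE h))))
        · exact .inr (.inr (.inr (hK.mp (hE h))))
  -- A pair occurs in `K` in one orientation only and is never an edge of `T`, so the graph
  -- determines the chosen subset.
  have hsub : ∀ E₁ E₂, E₁ ⊆ K → E₂ ⊆ K → F E₁ = F E₂ → E₁ ⊆ E₂ := by
    rintro E₁ E₂ h₁ h₂ heq ⟨a, w⟩ haw
    have hb := hK.mp (h₁ haw)
    have hne : a ≠ w := fun h => by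
      subst h
      exact hR.below_asymm hb hb
    have h : (F E₂).Adj a w := heq ▸ hF.mpr (.inr ⟨hne, .inl haw⟩)
    rcases hF.mp h with h | ⟨-, h | h⟩
    · exact absurd h (hnot hb)
    · exact h
    · exact absurd (hK.mp (h₂ h)) (hR.below_asymm hb)
  rw [himage, Set.ncard_coe_finset, Finset.card_image_of_injOn, Finset.card_powerset, hKcard]
  intro E₁ h₁ E₂ h₂ heq
  rw [Finset.mem_coe, Finset.mem_powerset] at h₁ h₂
  exact (hsub _ _ h₁ h₂ heq).antisymm (hsub _ _ h₂ h₁ heq.symm)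

/-! ### The simplex of a tree as an alcove -/

theorem CompleteRun.idxOf_root {n : ℕ} {R : Fin (n + 1) → Finset (Fin (n + 1))}
    {f : NFSState n} (h : CompleteRun R f) : f.visited.idxOf (Fin.last n) = 0 := by
  obtain ⟨t, ht⟩ := h.run.exists_visited_eq_cons
  rw [ht, List.idxOf_cons_self]

theorem CompleteRun.exists_perm {n : ℕ} {R : Fin (n + 1) → Finset (Fin (n + 1))}
    {f : NFSState n} (h : CompleteRun R f) :
    ∃ p : Equiv.Perm (Fin n), ∀ k : Fin n, f.visited.idxOf k.castSucc = p k + 1 := by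
  have hpos : ∀ k : Fin n, f.visited.idxOf k.castSucc ≠ 0 := by
    intro k hk
    rw [← h.idxOf_root, List.idxOf_inj (h.mem_visited _)] at hk
    exact (Fin.castSucc_lt_last k).ne hk
  have hlt : ∀ k : Fin n, f.visited.idxOf k.castSucc < n + 1 := fun k =>
    (List.idxOf_lt_length_of_mem (h.mem_visited _)).trans_eq h.length_visited
  let p : Fin n → Fin n := fun k =>
    ⟨f.visited.idxOf k.castSucc - 1, by have := hpos k; have := hlt k; omega⟩
  have hinj : Function.Injective p := by
    intro k l hkl
    have h1 : f.visited.idxOf k.castSucc - 1 = f.visited.idxOf l.castSucc - 1 :=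
      Fin.mk.inj_iff.mp hkl
    have h2 : f.visited.idxOf k.castSucc = f.visited.idxOf l.castSucc := by
      have := hpos k
      have := hpos l
      omega
    exact Fin.castSucc_injective n ((List.idxOf_inj (h.mem_visited _)).mp h2)
  refine ⟨Equiv.ofBijective p (Finite.injective_iff_bijective.mp hinj), fun k => ?_⟩
  have := hpos k
  simp only [Equiv.ofBijective_apply, p]
  omega

theorem treeSimplex_eq_alcove {n : ℕ} {T : SimpleGraph (Fin (n + 1))} {p : Equiv.Perm (Fin n)}
    (hp : ∀ k : Fin n, nfsPos T k.castSucc = p k + 1) :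
    treeSimplex T = alcove p fun k => exponent T k.castSucc := by
  have hcoord : ∀ (x : Fin n → ℝ) k, nodeCoord T x k.castSucc =
      scaled p (fun k => exponent T k.castSucc) k x := by
    intro x k
    rw [scaled_apply, nodeCoord, hp, coordVal, dif_pos (p k).isLt]
  simp only [treeSimplex, alcove, hcoord]

theorem exists_perm_nfsPos {n : ℕ} {T : SimpleGraph (Fin (n + 1))} (hT : T.IsTree) :
    ∃ p : Equiv.Perm (Fin n), ∀ k : Fin n, nfsPos T k.castSucc = p k + 1 := by
  classical
  obtain ⟨R, hR, -, -⟩ := exists_completeRun_of_isTree hT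
  exact hR.exists_perm

theorem eq_of_idxOf_eq {α : Type*} [DecidableEq α] {l₁ l₂ : List α} (h₁ : l₁.Nodup)
    (h₂ : l₂.Nodup) (hm : ∀ v, v ∈ l₁ ↔ v ∈ l₂) (h : ∀ v ∈ l₁, l₁.idxOf v = l₂.idxOf v) :
    l₁ = l₂ := by
  have hlen := ((List.perm_ext_iff_of_nodup h₁ h₂).mpr hm).length_eq
  refine List.ext_getElem hlen fun i hi hi' => ?_
  have h3 := h _ (List.getElem_mem hi)
  rw [h₁.idxOf_getElem] at h3
  have h4 := List.getElem_idxOf (List.idxOf_lt_length_of_mem ((hm _).mp (List.getElem_mem hi)))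
  simp only [← h3] at h4
  exact h4.symm

/-- A labeled tree is determined by the positions and the exponents of its nodes. -/
theorem eq_of_nfsPos_eq_of_exponent_eq {n : ℕ} {T T' : SimpleGraph (Fin (n + 1))}
    (hT : T.IsTree) (hT' : T'.IsTree)
    (hpos : ∀ k : Fin n, nfsPos T k.castSucc = nfsPos T' k.castSucc)
    (hexp : ∀ k : Fin n, exponent T k.castSucc = exponent T' k.castSucc) : T = T' := by
  classical
  obtain ⟨R, hR, htree, he⟩ := exists_completeRun_of_isTree hT
  obtain ⟨R', hR', htree', he'⟩ := exists_completeRun_of_isTree hT'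
  rw [← htree, ← htree']
  congr 1
  refine hR.run.unique hR'.run hR.pending hR'.pending ?_ fun w => ?_
  · refine eq_of_idxOf_eq hR.run.lists.1 hR'.run.lists.1
      (fun v => iff_of_true (hR.mem_visited v) (hR'.mem_visited v)) fun v _ => ?_
    induction v using Fin.lastCases with
    | last => rw [hR.idxOf_root, hR'.idxOf_root]
    | cast k => exact hpos k
  · rw [← he, ← he']
    induction w using Fin.lastCases with
    | last => rw [he, he', hR.run.root, hR'.run.root]
    | cast k => exact hexp k

/-! ### The simplices of trees lie in the Cayley polytope -/

theorem treeSimplex_subset {n : ℕ} {T : SimpleGraph (Fin (n + 1))} (hT : T.IsTree) :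
    treeSimplex T ⊆ cayleyPolytope n := by
  classical
  obtain ⟨R, hR, -, hexp⟩ := exists_completeRun_of_isTree hT
  obtain ⟨p, hp⟩ := hR.exists_perm
  rw [treeSimplex_eq_alcove hp]
  intro x hx
  have hlt : ∀ i : Fin n, (i : ℕ) + 1 < (nfsRun T).visited.length := fun i => by
    rw [hR.length_visited]
    omega
  have hget : ∀ i : Fin n, (nfsRun T).visited[(i : ℕ) + 1]'(hlt i) = (p.symm i).castSucc := by
    intro i
    have h1 := List.getElem_idxOf (List.idxOf_lt_length_of_mem
      (hR.mem_visited (p.symm i).castSucc))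
    simpa only [hp, Equiv.apply_symm_apply] using h1
  have hval := fun i => apply_eq_scaled p (fun k => exponent T k.castSucc) i x
  simp only [hexp] at hx hval
  intro i
  refine ⟨?_, fun hi => ?_, fun j hj => ?_⟩
  · rw [hval]
    exact one_le_mul_of_one_le_of_one_le (one_le_pow₀ one_le_two) (hx.1 _)
  -- At the start only the root is pending, so the node visited right after it has fewer than one
  -- node below it.
  · have h0 : (R (p.symm i).castSucc).card = 0 := by
      obtain ⟨rem, h1, h2⟩ := Reach.exists_visited_eq hR.run.reach (.init hR.run.root)
      have h3 : rem.head? = some (p.symm i).castSucc := by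
        rw [← hget i, List.head?_eq_getElem?]
        simp only [hi, h1, nfsInit, Nat.zero_add]
        rw [List.getElem_append_right (by simp)]
        have : 0 < rem.length := by
          have := hlt i
          rw [h1] at this
          simp [nfsInit] at this
          omega
        simp
      have := h2 _ h3
      simpa [nfsInit] using this
    rw [hval, h0, pow_zero, one_mul]
    exact hx.2.2 _
  · have hchain := List.isChain_iff_getElem.mp hR.run.isChain.1 (j + 1) (by rw [hj]; exact hlt i)
    have hgi : ∀ h, (nfsRun T).visited[(j : ℕ) + 1 + 1]'h = (p.symm i).castSucc := fun h => by
      simp only [hj, hget]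
    simp only [hgi, hget] at hchain
    rw [hval i, hval j, ← mul_assoc, ← pow_succ']
    -- If the exponent does not rise, the bounds `1` and `2` on the scaled coordinates suffice. If
    -- it rises by one, the label falls, and the order of the scaled coordinates gives the
    -- inequality.
    rcases hchain with h | ⟨h, hlt'⟩
    · calc _ ≤ (2 : ℝ) ^ (R (p.symm j).castSucc).card * 2 :=
            mul_le_mul (pow_le_pow_right₀ one_le_two h) (hx.2.2 _)
              (zero_le_one.trans (hx.1 _)) (by positivity)
        _ = (2 : ℝ) ^ ((R (p.symm j).castSucc).card + 1) * 1 := by rw [pow_succ, mul_one]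
        _ ≤ _ := by
            gcongr
            exact hx.1 _
    · rw [h]
      gcongr
      exact hx.2.1 _ _ (Fin.castSucc_lt_castSucc_iff.mp hlt').le

/-! ### The simplices of trees cover the Cayley polytope -/

/-- With `r` nodes left under the active node, its children must be the longest initial run with
exponents `r, r + 1, …`. A rise of the exponent forces a smaller label, so this run is decreasing as
required. -/
theorem exists_children {m : ℕ} (h : Fin m → ℕ) (l : List (Fin m)) (r : ℕ)
    (hl : l.IsChain fun u v => h v ≤ h u ∨ (h v = h u + 1 ∧ v < u))
    (hr : ∀ w ∈ l.head?, h w ≤ r) :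
    ∃ c l', l = c ++ l' ∧ c.IsChain (· > ·) ∧
      (∀ (i : ℕ) (hi : i < c.length), h (c.get ⟨i, hi⟩) = r + i) ∧
      ∀ w ∈ l'.head?, h w < r + c.length := by
  induction l generalizing r with
  | nil => exact ⟨[], [], by simp⟩
  | cons w l ih =>
    have hw := hr w (by simp)
    rcases hw.lt_or_eq with hlt | heq
    · exact ⟨[], w :: l, by simp, by simp, by simp, by simpa using hlt⟩
    · rw [List.isChain_cons] at hl
      obtain ⟨c, l', h1, h2, h3, h4⟩ := ih (r + 1) hl.2 fun v hv => by
        rcases hl.1 v hv with h' | h' <;> omega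
      refine ⟨w :: c, l', by rw [h1, List.cons_append], ?_, ?_, ?_⟩
      · rw [List.isChain_cons]
        refine ⟨fun v hv => ?_, h2⟩
        rcases c with _ | ⟨u, c⟩
        · simp at hv
        · simp only [List.head?_cons, Option.mem_some_iff] at hv
          subst hv
          have h5 := h3 0 (by simp)
          simp only [List.get_eq_getElem, List.getElem_cons_zero] at h5
          rcases hl.1 u (by simp [h1]) with h' | h'
          · omega
          · exact h'.2
      · rintro (_ | i) hi
        · exact heq
        · have := h3 i (by simpa using hi)
          simp only [List.get_eq_getElem, List.getElem_cons_succ] at this ⊢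
          omega
      · intro v hv
        have := h4 v hv
        rw [List.length_cons]
        omega

/-- The search is rebuilt from the order of visits and the exponents. A step with `k` children
changes the number of pending nodes by `k - 1` and that of unvisited ones by `-k`; the weight `2` on
the latter makes the bound `m` drop even when the stack grows. -/
theorem Run.exists_completion {n : ℕ} {h : Fin (n + 1) → ℕ} {L : List (Fin (n + 1))}
    (hL : L.Nodup) (m : ℕ) : ∀ (R : Fin (n + 1) → Finset (Fin (n + 1))) (s : NFSState n)
      (l : List (Fin (n + 1))), Run R s → s.pending.length + 2 * l.length ≤ m →
      s.visited ++ l = L → l.IsChain (fun u v => h v ≤ h u ∨ (h v = h u + 1 ∧ v < u)) →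
      (∀ w ∈ l.head?, h w < s.pending.length) → (∀ v ∈ s.visited, (R v).card = h v) →
      ∃ R f, Run R f ∧ f.pending = [] ∧ f.visited = L ∧ ∀ v ∈ f.visited, (R v).card = h v := by
  induction m with
  | zero =>
    intro R s l hR hm hvl hl hhead hcard
    have hl0 : l = [] := List.length_eq_zero_iff.mp (by omega)
    refine ⟨R, s, hR, List.length_eq_zero_iff.mp (by omega), ?_, hcard⟩
    rw [← hvl, hl0, List.append_nil]
  | succ m ih =>
    rintro R ⟨vis, _ | ⟨a, rest⟩, edg⟩ l hR hm hvl hl hhead hcard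
    · have hl0 : l = [] := by
        rcases l with _ | ⟨w, l⟩
        · rfl
        · exact absurd (hhead w (by simp)) (Nat.not_lt_zero _)
      exact ⟨R, _, hR, rfl, by rw [← hvl, hl0, List.append_nil], hcard⟩
    · simp only [List.length_cons] at hm hvl hhead hcard
      obtain ⟨c, l', rfl, hsort, hc, hl'⟩ := exists_children h l rest.length hl
        fun w hw => Nat.le_of_lt_succ (hhead w hw)
      have sorted : c.Pairwise (· > ·) := List.isChain_iff_pairwise.mp hsort
      have notMem : ∀ w ∈ c, w ∉ vis := by
        intro w hw hwv
        rw [← hvl] at hL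
        exact (List.nodup_append.mp hL).2.2 w hwv w (List.mem_append_left _ hw) rfl
      obtain ⟨R', hR', hvis, hnew⟩ := hR.extend sorted notMem
      refine ih R' _ l' hR' ?_ ?_ (List.isChain_append.mp hl).2.1 ?_ ?_
      · simp only [List.length_append, List.length_reverse] at hm ⊢
        omega
      · rw [← hvl, List.append_assoc]
      · intro w hw
        have := hl' w hw
        simp only [List.length_append, List.length_reverse]
        omega
      · intro v hv
        rcases List.mem_append.mp hv with hv | hv
        · rw [hvis v hv, hcard v hv]
        · obtain ⟨⟨i, hi⟩, rfl⟩ := List.mem_iff_get.mp hv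
          rw [hc, Step.card_new (hR.congr hvis) sorted notMem hnew]

/-- Every admissible sequence of exponents is attained by a labeled tree. -/
theorem exists_tree {n : ℕ} (p : Equiv.Perm (Fin n)) (e : Fin n → ℕ)
    (h0 : ∀ i : Fin n, (i : ℕ) = 0 → e i = 0)
    (h1 : ∀ i j : Fin n, (j : ℕ) + 1 = i →
      e i ≤ e j ∨ (e i = e j + 1 ∧ p.symm i < p.symm j)) :
    ∃ T : SimpleGraph (Fin (n + 1)), T.IsTree ∧
      (∀ k : Fin n, nfsPos T k.castSucc = p k + 1) ∧
      ∀ k : Fin n, exponent T k.castSucc = e (p k) := by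
  classical
  let l : List (Fin (n + 1)) := List.ofFn fun i => (p.symm i).castSucc
  let h : Fin (n + 1) → ℕ := Fin.lastCases 0 fun k => e (p k)
  have hlast : h (Fin.last n) = 0 := Fin.lastCases_last
  have hcast : ∀ k : Fin n, h k.castSucc = e (p k) := fun k => Fin.lastCases_castSucc k
  have hL : (Fin.last n :: l).Nodup := by
    rw [List.nodup_cons]
    constructor
    · rw [List.mem_ofFn]
      rintro ⟨i, hi⟩
      exact (Fin.castSucc_lt_last _).ne hi
    · exact List.nodup_ofFn.mpr ((Fin.castSucc_injective n).comp p.symm.injective)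
  have hchain : l.IsChain fun u v => h v ≤ h u ∨ (h v = h u + 1 ∧ v < u) := by
    rw [List.isChain_iff_getElem]
    intro i hi
    simp only [l, List.getElem_ofFn, hcast, Equiv.apply_symm_apply,
      Fin.castSucc_lt_castSucc_iff]
    exact h1 _ _ rfl
  obtain ⟨R, f, hR, hpend, hvis, hcard⟩ := Run.exists_completion (h := h) hL _ (fun _ => ∅)
    (nfsInit n) l (.init rfl) le_rfl rfl hchain (by
      intro w hw
      rw [List.head?_eq_getElem?, Option.mem_def, List.getElem?_eq_some_iff] at hw
      obtain ⟨hlen, rfl⟩ := hw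
      simp only [l, List.getElem_ofFn, hcast, Equiv.apply_symm_apply]
      rw [h0 _ rfl]
      exact Nat.one_pos) (by simp [nfsInit, hlast])
  have hf : CompleteRun R f := ⟨hR, hpend, fun v => by
    rw [hvis]
    induction v using Fin.lastCases with
    | last => exact List.mem_cons_self
    | cast k => exact List.mem_cons_of_mem _ (List.mem_ofFn.mpr ⟨p k, by simp⟩)⟩
  refine ⟨f.tree, hf.isTree, fun k => ?_, fun k => ?_⟩
  · rw [nfsPos, hf.nfsRun_tree, hvis]
    have hlen : (p k : ℕ) + 1 < (Fin.last n :: l).length := by simp [l]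
    have hget : (Fin.last n :: l)[(p k : ℕ) + 1] = k.castSucc := by simp [l]
    rw [← hget, hL.idxOf_getElem]
  · rw [hf.exponent_tree, hcard _ (hf.mem_visited _), hcast]

theorem exists_mem_treeSimplex {n : ℕ} {x : Fin n → ℝ} (hx : x ∈ cayleyPolytope n) :
    ∃ T : SimpleGraph (Fin (n + 1)), T.IsTree ∧ x ∈ treeSimplex T := by
  have hex : ∀ i, ∃ m : ℕ, x i ≤ 2 ^ (m + 1) := fun i => by
    obtain ⟨m, hm⟩ := pow_unbounded_of_one_lt (x i) one_lt_two
    exact ⟨m, hm.le.trans (pow_le_pow_right₀ one_le_two m.le_succ)⟩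
  classical
  -- A power of two above `1` gets the lower of its two possible exponents. Thus `x_1 ≤ 2` gives
  -- exponent `0`, and `x_i ≤ 2 x_{i-1}` allows a rise by at most one, even where equality holds.
  let e : Fin n → ℕ := fun i => Nat.find (hex i)
  have hup : ∀ i, x i ≤ 2 ^ (e i + 1) := fun i => Nat.find_spec (hex i)
  have hmin : ∀ i m, x i ≤ 2 ^ (m + 1) → e i ≤ m := fun i m h => Nat.find_min' (hex i) h
  have hlow : ∀ i, 2 ^ e i ≤ x i := by
    intro i
    rcases Nat.eq_zero_or_pos (e i) with h | h
    · rw [h, pow_zero]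
      exact (hx i).1
    · by_contra hlt
      have := hmin i (e i - 1) (by rw [Nat.sub_add_cancel h]; exact (not_le.mp hlt).le)
      omega
  let c : Fin n → ℝ := fun i => x i / 2 ^ e i
  -- Ties are broken in favor of the later position: where the exponent rises by one, `c i ≤ c j`
  -- may be an equality, and the later node still needs the smaller label.
  let key : Fin n → ℝ ×ₗ (Fin n)ᵒᵈ := fun i => toLex (c i, OrderDual.toDual i)
  let p := Tuple.sort key
  have hmono : ∀ k l, k ≤ l → key (p k) ≤ key (p l) := fun k l h => Tuple.monotone_sort key h
  obtain ⟨T, hT, hpos, hexp⟩ := exists_tree p e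
    (fun i hi => Nat.le_zero.mp (hmin i 0 (by simpa using (hx i).2.1 hi))) (by
      intro i j hij
      have hle := (hx i).2.2 j hij
      have he : e i ≤ e j + 1 := hmin i _ (by
        rw [pow_succ']
        exact hle.trans (mul_le_mul_of_nonneg_left (hup j) two_pos.le))
      rcases he.lt_or_eq with h | h
      · exact .inl (Nat.le_of_lt_succ h)
      · refine .inr ⟨h, ?_⟩
        by_contra hlt
        have hk := hmono _ _ (not_lt.mp hlt)
        simp only [Equiv.apply_symm_apply, key, Prod.Lex.toLex_le_toLex] at hk
        have hc : c i ≤ c j := by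
          simp only [c]
          rw [h, div_le_div_iff₀ (by positivity) (by positivity), pow_succ']
          calc x i * 2 ^ e j ≤ 2 * x j * 2 ^ e j := by gcongr
            _ = _ := by ring
        rcases hk with hk | ⟨-, hk⟩
        · exact absurd hk hc.not_gt
        · have h2 : i ≤ j := hk
          have h3 : (i : ℕ) ≤ j := h2
          omega)
  refine ⟨T, hT, ?_⟩
  rw [treeSimplex_eq_alcove hpos]
  simp only [hexp]
  refine ⟨fun k => ?_, fun k l hkl => ?_, fun k => ?_⟩ <;> simp only [scaled_apply]
  · rw [one_le_div (by positivity)]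
    exact hlow _
  · rcases Prod.Lex.toLex_le_toLex.mp (hmono k l hkl) with h | h
    · exact h.le
    · exact h.1.le
  · rw [div_le_iff₀ (by positivity), ← pow_succ']
    exact hup _

theorem iUnion_treeSimplex (n : ℕ) :
    ⋃ T : {T : SimpleGraph (Fin (n + 1)) // T.IsTree}, treeSimplex T.1 = cayleyPolytope n := by
  refine subset_antisymm (Set.iUnion_subset fun T => treeSimplex_subset T.2) fun x hx => ?_
  obtain ⟨T, hT, hxT⟩ := exists_mem_treeSimplex hx
  exact Set.mem_iUnion.mpr ⟨⟨T, hT⟩, hxT⟩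

/-- Connected graphs are sorted by their search trees, matching the decomposition of the polytope
into simplices. -/
theorem ncard_connected (n : ℕ) : {G : SimpleGraph (Fin (n + 1)) | G.Connected}.ncard =
    ∑ᶠ T : {T : SimpleGraph (Fin (n + 1)) // T.IsTree},
      {G : SimpleGraph (Fin (n + 1)) | G.Connected ∧ nfsTree G = T.1}.ncard := by
  classical
  have hunion : {G : SimpleGraph (Fin (n + 1)) | G.Connected} =
      ⋃ T : {T : SimpleGraph (Fin (n + 1)) // T.IsTree}, {G | G.Connected ∧ nfsTree G = T.1} := by
    ext G
    simp only [Set.mem_ofPred_eq, Set.mem_iUnion]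
    exact ⟨fun h => ⟨⟨nfsTree G, isTree_nfsTree h⟩, h, rfl⟩, fun ⟨_, h, _⟩ => h⟩
  rw [hunion]
  refine Set.ncard_iUnion_of_finite (fun _ => Set.toFinite _) fun T T' hne => ?_
  rw [Function.onFun, Set.disjoint_left]
  exact fun G h h' => hne (Subtype.ext (h.2.symm.trans h'.2))

end CayleyPolytope

open CayleyPolytope in
theorem theorem3p2 (n : ℕ) :
    (∀ T : SimpleGraph (Fin (n + 1)), T.IsTree →
      CayleyPolytope.IsSimplex (CayleyPolytope.treeSimplex T) ∧
      CayleyPolytope.IsOrthoscheme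
        (fun m : Fin n => (2 : ℝ) ^ CayleyPolytope.exponent T m.rev.castSucc)
        (CayleyPolytope.treeSimplex T) ∧
      (n ! : ℝ≥0∞) * MeasureTheory.volume (CayleyPolytope.treeSimplex T) =
        ({G : SimpleGraph (Fin (n + 1)) |
          G.Connected ∧ CayleyPolytope.nfsTree G = T}.ncard : ℝ≥0∞) ∧
      {G : SimpleGraph (Fin (n + 1)) |
        G.Connected ∧ CayleyPolytope.nfsTree G = T}.ncard = 2 ^ CayleyPolytope.alpha T) ∧
    CayleyPolytope.IsTriangulation
      (fun T : {T : SimpleGraph (Fin (n + 1)) // T.IsTree} => CayleyPolytope.treeSimplex T.1)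
      (CayleyPolytope.cayleyPolytope n) ∧
    (n ! : ℝ≥0∞) * MeasureTheory.volume (CayleyPolytope.cayleyPolytope n) =
      ({G : SimpleGraph (Fin (n + 1)) | G.Connected}.ncard : ℝ≥0∞) := by
  classical
  have hortho : ∀ T : SimpleGraph (Fin (n + 1)), T.IsTree →
      IsOrthoscheme (fun m : Fin n => (2 : ℝ) ^ exponent T m.rev.castSucc) (treeSimplex T) := by
    intro T hT
    obtain ⟨p, hp⟩ := exists_perm_nfsPos hT
    rw [treeSimplex_eq_alcove hp]
    exact isOrthoscheme_alcove p fun k => exponent T k.castSucc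
  have hvol : ∀ T : SimpleGraph (Fin (n + 1)), T.IsTree →
      (n ! : ℝ≥0∞) * MeasureTheory.volume (treeSimplex T) =
        ({G : SimpleGraph (Fin (n + 1)) | G.Connected ∧ nfsTree G = T}.ncard : ℝ≥0∞) := by
    intro T hT
    obtain ⟨p, hp⟩ := exists_perm_nfsPos hT
    rw [treeSimplex_eq_alcove hp, volume_alcove, ncard_nfsTree_fiber hT, alpha]
    norm_num
  choose p hp using fun T : {T : SimpleGraph (Fin (n + 1)) // T.IsTree} => exists_perm_nfsPos T.2
  have halc := fun T => treeSimplex_eq_alcove (hp T)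
  have hne : ∀ T T' : {T : SimpleGraph (Fin (n + 1)) // T.IsTree}, T ≠ T' →
      ¬ (p T = p T' ∧ (fun k : Fin n => exponent T.1 k.castSucc) =
        fun k => exponent T'.1 k.castSucc) := by
    rintro T T' hTT' ⟨h1, h2⟩
    exact hTT' (Subtype.ext (eq_of_nfsPos_eq_of_exponent_eq T.2 T'.2
      (fun k => by rw [hp, hp, h1]) (congrFun h2)))
  refine ⟨fun T hT => ⟨(hortho T hT).isSimplex, hortho T hT, hvol T hT, ncard_nfsTree_fiber hT⟩,
    ⟨inferInstance, fun T => (hortho T.1 T.2).isSimplex, iUnion_treeSimplex n,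
      fun T T' hTT' => ?_, fun T T' => ?_⟩, ?_⟩
  · simp only [halc]
    exact disjoint_interior_alcove (hne T T' hTT')
  · simp only [halc]
    refine ⟨isExposed_alcove_inter _ _ _ _, ?_⟩
    rw [Set.inter_comm]
    exact isExposed_alcove_inter _ _ _ _
  · have := Fintype.ofFinite {T : SimpleGraph (Fin (n + 1)) // T.IsTree}
    -- The simplices share boundary points, so additivity of the volume is used in its form for null
    -- overlaps.
    rw [← iUnion_treeSimplex, MeasureTheory.measure_iUnion₀, tsum_fintype, Finset.mul_sum,
      ncard_connected, finsum_eq_sum_of_fintype, Nat.cast_sum]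
    · exact Finset.sum_congr rfl fun T _ => hvol T.1 T.2
    · intro T T' hTT'
      simp only [Function.onFun, halc]
      exact volume_alcove_inter (hne T T' hTT')
    · intro T
      rw [halc]
      exact (isClosed_alcove _ _).measurableSet.nullMeasurableSet
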